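/- Let $d\ge 0$ be an integer, $L\in GL(2d,\mathbb R)$, $L^{-T}:=(L^{-1})^T$, $I_1=(I,0)$ and $I_2=(0,I)$ the $d\times 2d$ block projections, and $\mathcal J=\begin{pmatrix}0&-I\\ I&0\end{pmatrix}$. For $z=(x,\omega)\in\mathbb R^{2d}$ and $u\in\mathcal S(\mathbb R^d)$ let $(\pi_zu)(t)=e^{2\pi i\langle\omega,t\rangle}u(t-x)$. Let $p\in\mathcal D'(\mathbb R^{2d})$ be $L$-periodic, i.e. $\langle p,f(\cdot+L\kappa)\rangle=\langle p,f\rangle$ for all $\kappa\in\mathbb Z^{2d}$, $f\in C_0^\infty(\mathbb R^{2d})$ (equivalently, $p\in\mathcal D'(\mathbb T^{2d}_L)$, $\mathbb T^{2d}_L=\mathbb R^{2d}/L\mathbb Z^{2d}$). Then $p$ extends uniquely to a tempered distribution, still denoted $p\in\mathcal S'(\mathbb R^{2d})$. There is $\phi\in C_0^\infty(\mathbb R^{2d})$ with $\sum_{\kappa\in\mathbb Z^{2d}}\phi(z-L\kappa)=1$ for all $z\in\mathbb R^{2d}$. For any such $\phi$ let $$c_\kappa(p)=\frac1{|\det L|}\big\langle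 p,\ \phi\,e^{-2\pi i\langle L^{-T}\kappa,\cdot\rangle}\big\rangle ,\qquad \kappa\in\mathbb Z^{2d},$$ be the Fourier coefficients of $p$. For $\tau\in[0,1]$ and $u\in\mathcal S(\mathbb R^d)$ let $\mathrm{Op}_\tau(p)u\in\mathcal S'(\mathbb R^d)$ be $$\mathrm{Op}_\tau(p)u(x)=\int_{\mathbb R^d}\int_{\mathbb R^d}e^{2\pi i\langle x-y,\omega\rangle}\,p\big((1-\tau)x+\tau y,\omega\big)\,u(y)\,dy\,d\omega$$ in the sense of distributions, i.e. $\langle \mathrm{Op}_\tau(p)u,v\rangle=\langle p,W_\tau(u,v)\rangle$ for $v\in\mathcal S(\mathbb R^d)$, where $W_\tau(u,v)(s,\omega)=\int_{\mathbb R^d}e^{2\pi i\langle t,\omega\rangle}u(s-(1-\tau)t)\,v(s+\tau t)\,dt$. Then for every $\tau\in[0,1]$ and every $u\in\mathcal S(\mathbb R^d)$ $$\mathrm{Op}_\tau(p)u=\sum_{\kappa\in\mathbb Z^{2d}}c_\kappa(p)\,e^{2\pi i\tau\langle I_2L^{-T}\kappa,\ I_1L^{-T}\kappa\rangle}\ \pi_{\mathcal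 JL^{-T}\kappa}\,u ,$$ where the series converges unconditionally (with respect to finite subsets of $\mathbb Z^{2d}$) in $\mathcal S'(\mathbb R^d)$ with the weak-$*$ topology. -/

import Mathlib

open MeasureTheory
open scoped SchwartzMap FourierTransform ContDiff Distributions

noncomputable section

namespace TauQuantization

/-- The configuration space `ℝᵈ`. -/
abbrev Config (d : ℕ) : Type := EuclideanSpace ℝ (Fin d)

/-- The phase space `ℝ²ᵈ`, with points `z = (x, ω)`: the coordinates of `x` are indexed by the left
summand of `Fin d ⊕ Fin d`, those of `ω` by the right one. -/
abbrev PhaseSpace (d : ℕ) : Type := EuclideanSpace ℝ (Fin d ⊕ Fin d)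

namespace PhaseSpace
variable {d : ℕ}

/-- The block projection `(I, 0)`, that is `(x, ω) ↦ x`. -/
def fst : PhaseSpace d →L[ℝ] Config d :=
  LinearMap.toContinuousLinearMap
    { toFun := fun z => WithLp.toLp 2 fun i => z (Sum.inl i)
      map_add' := fun _ _ => rfl
      map_smul' := fun _ _ => rfl }

/-- The block projection `(0, I)`, that is `(x, ω) ↦ ω`. -/
def snd : PhaseSpace d →L[ℝ] Config d :=
  LinearMap.toContinuousLinearMap
    { toFun := fun z => WithLp.toLp 2 fun i => z (Sum.inr i)
      map_add' := fun _ _ => rfl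
      map_smul' := fun _ _ => rfl }

@[simp] theorem fst_apply (z : PhaseSpace d) (i : Fin d) : fst z i = z (Sum.inl i) := rfl

@[simp] theorem snd_apply (z : PhaseSpace d) (i : Fin d) : snd z i = z (Sum.inr i) := rfl

theorem norm_sq_eq (z : PhaseSpace d) : ‖z‖ ^ 2 = ‖fst z‖ ^ 2 + ‖snd z‖ ^ 2 := by
  simp [EuclideanSpace.norm_sq_eq, Fintype.sum_sum_type]

theorem norm_fst_le (z : PhaseSpace d) : ‖fst z‖ ≤ ‖z‖ := by
  have := norm_sq_eq z
  exact abs_le_of_sq_le_sq' (by nlinarith [sq_nonneg ‖snd z‖]) (norm_nonneg _) |>.2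

theorem norm_snd_le (z : PhaseSpace d) : ‖snd z‖ ≤ ‖z‖ := by
  have := norm_sq_eq z
  exact abs_le_of_sq_le_sq' (by nlinarith [sq_nonneg ‖fst z‖]) (norm_nonneg _) |>.2

theorem norm_le_add (z : PhaseSpace d) : ‖z‖ ≤ ‖fst z‖ + ‖snd z‖ := by
  have := norm_sq_eq z
  refine abs_le_of_sq_le_sq' ?_ (by positivity) |>.2
  nlinarith [mul_nonneg (norm_nonneg (fst z)) (norm_nonneg (snd z))]

theorem inner_eq (z w : PhaseSpace d) :
    inner ℝ z w = inner ℝ (fst z) (fst w) + inner ℝ (snd z) (snd w) := by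
  simp [PiLp.inner_apply, Fintype.sum_sum_type]

/-- `z ↦ (x, ω)` as a measurable equivalence. -/
def equivProd : PhaseSpace d ≃ᵐ Config d × Config d :=
  (MeasurableEquiv.toLp 2 (Fin d ⊕ Fin d → ℝ)).symm.trans <|
    (MeasurableEquiv.sumPiEquivProdPi fun _ => ℝ).trans <|
      (MeasurableEquiv.toLp 2 (Fin d → ℝ)).prodCongr (MeasurableEquiv.toLp 2 (Fin d → ℝ))

theorem equivProd_apply (z : PhaseSpace d) : equivProd z = (fst z, snd z) := rfl

theorem measurePreserving_equivProd :
    MeasurePreserving (equivProd (d := d)) volume (volume.prod volume) :=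
  ((PiLp.volume_preserving_toLp (Fin d)).prod (PiLp.volume_preserving_toLp (Fin d))).comp <|
    (volume_measurePreserving_sumPiEquivProdPi fun _ => ℝ).comp <|
      EuclideanSpace.volume_preserving_symm_measurableEquiv_toLp (Fin d ⊕ Fin d)

theorem integrable_comp_iff (F : Config d × Config d → ℂ) :
    Integrable (fun z : PhaseSpace d => F (fst z, snd z)) ↔ Integrable F (volume.prod volume) :=
  measurePreserving_equivProd.integrable_comp_emb equivProd.measurableEmbedding

theorem integral_eq_prod (F : Config d × Config d → ℂ) :
    ∫ z : PhaseSpace d, F (fst z, snd z) = ∫ q, F q ∂(volume.prod volume) :=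
  measurePreserving_equivProd.integral_comp equivProd.measurableEmbedding F

end PhaseSpace

theorem hasTemperateGrowth_exp_I : (fun x : ℝ => Complex.exp (x * Complex.I)).HasTemperateGrowth := by
  refine ⟨(Complex.ofRealCLM.contDiff.mul contDiff_const).cexp, fun n => ⟨0, 1, fun x => ?_⟩⟩
  rw [norm_iteratedFDeriv_eq_norm_iteratedDeriv]
  have h : ∀ n : ℕ, iteratedDeriv n (fun x : ℝ => Complex.exp (x * Complex.I)) =
      fun x : ℝ => Complex.I ^ n * Complex.exp (x * Complex.I) := by
    intro n
    induction n with
    | zero => simp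
    | succ n ih =>
      rw [iteratedDeriv_succ, ih]
      funext x
      have h1 : HasDerivAt (fun x : ℝ => Complex.exp (x * Complex.I))
          (Complex.exp (x * Complex.I) * (1 * Complex.I)) x :=
        ((hasDerivAt_id x).ofReal_comp.mul_const Complex.I).cexp
      rw [(h1.const_mul _).deriv]
      ring
  rw [h]
  simp [Complex.norm_exp_ofReal_mul_I]

theorem bound_aux (a b A B : ℝ) (k : ℕ) (ha : 0 ≤ a) (hb : 0 ≤ b) (hA : 0 ≤ A) (hB : 0 ≤ B) :
    (a + b) ^ k * (A * B) ≤ 2 ^ k * ((a ^ k * A) * B + A * (b ^ k * B)) := by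
  have h : (a + b) ^ k ≤ 2 ^ k * (a ^ k + b ^ k) := by
    have h1 : (a + b) ^ k ≤ (2 * max a b) ^ k := by
      gcongr
      linarith [le_max_left a b, le_max_right a b]
    refine h1.trans ?_
    rw [mul_pow]
    gcongr
    rcases max_cases a b with h | h <;> rw [h.1] <;> nlinarith [pow_nonneg ha k, pow_nonneg hb k]
  calc (a + b) ^ k * (A * B) ≤ 2 ^ k * (a ^ k + b ^ k) * (A * B) := by gcongr
    _ = _ := by ring

section Wigner
open PhaseSpace SchwartzMap
variable {d : ℕ}

/-- `v ↦ v ⊗ w`, the function `(x, ω) ↦ v x * w ω`. -/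
def tensorCLM (w : 𝓢(Config d, ℂ)) : 𝓢(Config d, ℂ) →L[ℂ] 𝓢(PhaseSpace d, ℂ) :=
  SchwartzMap.mkCLM (fun v z => v (fst z) * w (snd z)) (fun _ _ _ => by simp [add_mul])
    (fun _ _ _ => by simp [mul_assoc])
    (fun v => ((v.smooth ⊤).comp fst.contDiff).mul ((w.smooth ⊤).comp snd.contDiff)) <| by
  rintro ⟨k, n⟩
  refine ⟨Finset.Iic (k, n), ∑ i ∈ Finset.range (n + 1), (n.choose i : ℝ) * (2 ^ k *
    (SchwartzMap.seminorm ℂ 0 (n - i) w + SchwartzMap.seminorm ℂ k (n - i) w)), ?_, ?_⟩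
  · positivity
  intro v z
  have hb : ∀ (f : 𝓢(Config d, ℂ)) (P : PhaseSpace d →L[ℝ] Config d), ‖P‖ ≤ 1 → ∀ i : ℕ,
      ‖iteratedFDeriv ℝ i (fun z => f (P z)) z‖ ≤ ‖iteratedFDeriv ℝ i f (P z)‖ := by
    intro f P hP i
    have := P.iteratedFDeriv_comp_right (f.smooth ⊤) z (i := i) (by exact_mod_cast le_top)
    change ‖iteratedFDeriv ℝ i (f ∘ P) z‖ ≤ _
    rw [this]
    refine (ContinuousMultilinearMap.norm_compContinuousLinearMap_le _ _).trans ?_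
    refine mul_le_of_le_one_right (norm_nonneg _) ?_
    exact Finset.prod_le_one (fun _ _ => norm_nonneg _) (fun _ _ => hP)
  have hf1 : ‖(fst : PhaseSpace d →L[ℝ] Config d)‖ ≤ 1 :=
    ContinuousLinearMap.opNorm_le_bound _ zero_le_one fun z => by simpa using norm_fst_le z
  have hs1 : ‖(snd : PhaseSpace d →L[ℝ] Config d)‖ ≤ 1 :=
    ContinuousLinearMap.opNorm_le_bound _ zero_le_one fun z => by simpa using norm_snd_le z
  have hmul := norm_iteratedFDeriv_mul_le (𝕜 := ℝ) (n := n) (N := ∞)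
    (f := fun z : PhaseSpace d => v (fst z)) (g := fun z : PhaseSpace d => w (snd z))
    ((v.smooth ⊤).comp fst.contDiff) ((w.smooth ⊤).comp snd.contDiff) z
    (by exact_mod_cast le_top)
  have hsem : ∀ (k' i : ℕ), k' ≤ k → i ≤ n → SchwartzMap.seminorm ℂ k' i v ≤
      (Finset.Iic (k, n)).sup (schwartzSeminormFamily ℂ (Config d) ℂ) v := by
    intro k' i hk hi
    have : schwartzSeminormFamily ℂ (Config d) ℂ (k', i) ≤
      (Finset.Iic (k, n)).sup (schwartzSeminormFamily ℂ (Config d) ℂ) :=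
      Finset.le_sup (by simp [hk, hi])
    exact this v
  set S := (Finset.Iic (k, n)).sup (schwartzSeminormFamily ℂ (Config d) ℂ) v
  calc ‖z‖ ^ k * ‖iteratedFDeriv ℝ n (fun z => v (fst z) * w (snd z)) z‖
      ≤ (‖fst z‖ + ‖snd z‖) ^ k * ∑ i ∈ Finset.range (n + 1), (n.choose i : ℝ) *
        ‖iteratedFDeriv ℝ i v (fst z)‖ * ‖iteratedFDeriv ℝ (n - i) w (snd z)‖ := by
        gcongr
        · exact norm_le_add z
        · refine hmul.trans ?_
          gcongr with i hi
          · exact hb v fst hf1 i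
          · exact hb w snd hs1 _
    _ = ∑ i ∈ Finset.range (n + 1), (n.choose i : ℝ) * ((‖fst z‖ + ‖snd z‖) ^ k *
        (‖iteratedFDeriv ℝ i v (fst z)‖ * ‖iteratedFDeriv ℝ (n - i) w (snd z)‖)) := by
        rw [Finset.mul_sum]
        exact Finset.sum_congr rfl fun i _ => by ring
    _ ≤ ∑ i ∈ Finset.range (n + 1), (n.choose i : ℝ) * (2 ^ k *
        (S * SchwartzMap.seminorm ℂ 0 (n - i) w + S * SchwartzMap.seminorm ℂ k (n - i) w)) := by
        refine Finset.sum_le_sum fun i hi => mul_le_mul_of_nonneg_left ?_ (Nat.cast_nonneg _)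
        have hi' : i ≤ n := by simpa [Nat.lt_succ_iff] using hi
        refine (bound_aux ‖fst z‖ ‖snd z‖ ‖iteratedFDeriv ℝ i v (fst z)‖
          ‖iteratedFDeriv ℝ (n - i) w (snd z)‖ k (norm_nonneg _) (norm_nonneg _) (norm_nonneg _)
          (norm_nonneg _)).trans ?_
        gcongr
        · exact (v.le_seminorm ℂ k i _).trans (hsem k i le_rfl hi')
        · exact SchwartzMap.norm_iteratedFDeriv_le_seminorm (𝕜 := ℂ) w _ _
        · exact (SchwartzMap.norm_iteratedFDeriv_le_seminorm (𝕜 := ℂ) v _ _).trans (hsem 0 i (Nat.zero_le _) hi')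
        · exact w.le_seminorm ℂ k _ _
    _ = _ := by
        rw [Finset.sum_mul]
        exact Finset.sum_congr rfl fun i _ => by ring


@[simp] theorem tensorCLM_apply (w v : 𝓢(Config d, ℂ)) (z : PhaseSpace d) :
    tensorCLM w v z = v (fst z) * w (snd z) := rfl

end Wigner

/-- `planeWave ξ t = e^{2πi⟨ξ, t⟩}`. -/
def planeWave {E : Type*} [NormedAddCommGroup E] [InnerProductSpace ℝ E] (ξ t : E) : ℂ :=
  Complex.exp ((2 * Real.pi * inner ℝ ξ t : ℝ) * Complex.I)

section planeWave
variable {E : Type*} [NormedAddCommGroup E] [InnerProductSpace ℝ E]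

theorem planeWave_hasTemperateGrowth (ξ : E) : (planeWave ξ).HasTemperateGrowth :=
  hasTemperateGrowth_exp_I.comp (f := fun t => 2 * Real.pi * inner ℝ ξ t) (by fun_prop)

theorem planeWave_contDiff (ξ : E) : ContDiff ℝ ∞ (planeWave ξ) :=
  (planeWave_hasTemperateGrowth ξ).1

@[simp] theorem norm_planeWave (ξ t : E) : ‖planeWave ξ t‖ = 1 := Complex.norm_exp_ofReal_mul_I _

theorem planeWave_comm (ξ t : E) : planeWave ξ t = planeWave t ξ := by
  rw [planeWave, real_inner_comm, planeWave]

theorem planeWave_add (ξ t s : E) : planeWave ξ (t + s) = planeWave ξ t * planeWave ξ s := by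
  simp only [planeWave, inner_add_right, ← Complex.exp_add]
  congr 1; push_cast; ring

theorem planeWave_neg (ξ t : E) : planeWave (-ξ) t = planeWave ξ (-t) := by
  simp [planeWave]

end planeWave

theorem chirp_hasTemperateGrowth {d : ℕ} (c : ℝ) :
    (fun z : PhaseSpace d =>
      planeWave (c • PhaseSpace.fst z) (PhaseSpace.snd z)).HasTemperateGrowth := by
  unfold planeWave
  refine hasTemperateGrowth_exp_I.comp
    (f := fun z : PhaseSpace d => 2 * Real.pi * inner ℝ (c • PhaseSpace.fst z) (PhaseSpace.snd z)) ?_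
  refine (Function.HasTemperateGrowth.const _).mul ?_
  exact (innerSL ℝ).bilinear_hasTemperateGrowth
    (f := fun z : PhaseSpace d => c • PhaseSpace.fst z) (g := fun z : PhaseSpace d => PhaseSpace.snd z)
    (c • PhaseSpace.fst).hasTemperateGrowth PhaseSpace.snd.hasTemperateGrowth


section Wigner
open PhaseSpace SchwartzMap
variable {d : ℕ}

/-- Auxiliary: the map `v ↦ crossWigner τ u v` below, written as a composition of continuous operators
on Schwartz space (see `wignerAux_apply` for the integral formula). -/
def wignerAux (τ : ℝ) (u : 𝓢(Config d, ℂ)) : 𝓢(Config d, ℂ) →L[ℂ] 𝓢(PhaseSpace d, ℂ) :=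
  FourierTransform.fourierInvCLM ℂ 𝓢(PhaseSpace d, ℂ) ∘L
    smulLeftCLM ℂ (fun z : PhaseSpace d => planeWave (τ • fst z) (snd z)) ∘L
      FourierTransform.fourierCLM ℂ 𝓢(PhaseSpace d, ℂ) ∘L
        smulLeftCLM ℂ (fun z : PhaseSpace d => planeWave ((1 : ℝ) • fst z) (snd z)) ∘L
          tensorCLM (𝓕 u)

theorem inversion_apply (f : 𝓢(Config d, ℂ)) (x : Config d) :
    f x = ∫ w, planeWave w x * 𝓕 f w := by
  have h : 𝓕⁻ (𝓕 f) = f := FourierTransform.fourierInv_fourier_eq f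
  have h' : (𝓕⁻ (𝓕 f)) x = ∫ w, planeWave w x * 𝓕 f w := by
    rw [fourierInv_coe, Real.fourierInv_eq']
    rfl
  rw [← h', h]

theorem wignerAux_apply (τ : ℝ) (u v : 𝓢(Config d, ℂ)) (z : PhaseSpace d) :
    wignerAux τ u v z =
      ∫ t, planeWave t (snd z) * u (fst z - (1 - τ) • t) * v (fst z + τ • t) := by
  set Φ : 𝓢(PhaseSpace d, ℂ) :=
    smulLeftCLM ℂ (fun z : PhaseSpace d => planeWave ((1 : ℝ) • fst z) (snd z))
      (tensorCLM (𝓕 u) v) with hΦ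
  have hΦ_apply : ∀ z, Φ z = planeWave (fst z) (snd z) * (v (fst z) * 𝓕 u (snd z)) := by
    intro z
    rw [hΦ, smulLeftCLM_apply_apply (chirp_hasTemperateGrowth 1)]
    simp
  have hwave_cont : ∀ {X : Type} [TopologicalSpace X] (f g : X → Config d), Continuous f →
      Continuous g → Continuous fun x => planeWave (f x) (g x) := by
    intro X _ f g hf hg
    unfold planeWave
    fun_prop
  -- the full Fourier transform of `Φ`
  have hA : ∀ ζ : PhaseSpace d, 𝓕 Φ ζ =
      ∫ x, planeWave (-x) (fst ζ) * (v x * u (x - snd ζ)) := by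
    intro ζ
    have h1 : 𝓕 Φ ζ = ∫ y : PhaseSpace d, (fun q : Config d × Config d =>
        planeWave (-q.1) (fst ζ) * planeWave (-q.2) (snd ζ) *
          (planeWave q.1 q.2 * (v q.1 * 𝓕 u q.2))) (fst y, snd y) := by
      rw [fourier_coe, Real.fourier_eq']
      refine integral_congr_ae (Filter.Eventually.of_forall fun y => ?_)
      simp only [hΦ_apply, smul_eq_mul, inner_eq]
      congr 1
      simp only [planeWave, ← Complex.exp_add, inner_neg_left]
      congr 1; push_cast; ring
    have hint : Integrable (fun q : Config d × Config d =>
        planeWave (-q.1) (fst ζ) * planeWave (-q.2) (snd ζ) *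
          (planeWave q.1 q.2 * (v q.1 * 𝓕 u q.2))) (volume.prod volume) := by
      refine (integrable_comp_iff _).1 ?_
      refine Φ.integrable.mono ?_ (Filter.Eventually.of_forall fun y => ?_)
      · refine Continuous.aestronglyMeasurable ?_
        have := hwave_cont (fun z : PhaseSpace d => -fst z) (fun _ => fst ζ) (by fun_prop)
          (by fun_prop)
        have := hwave_cont (fun z : PhaseSpace d => -snd z) (fun _ => snd ζ) (by fun_prop)
          (by fun_prop)
        have := hwave_cont (fun z : PhaseSpace d => fst z) (fun z => snd z) (by fun_prop)
          (by fun_prop)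
        fun_prop
      · simp [hΦ_apply]
    rw [h1.trans (integral_eq_prod fun q : Config d × Config d =>
        planeWave (-q.1) (fst ζ) * planeWave (-q.2) (snd ζ) *
          (planeWave q.1 q.2 * (v q.1 * 𝓕 u q.2))), integral_prod _ hint]
    refine integral_congr_ae (Filter.Eventually.of_forall fun x => ?_)
    have hinv : u (x - snd ζ) = ∫ w, planeWave w (x - snd ζ) * 𝓕 u w := by
      exact inversion_apply u _
    simp only
    rw [hinv, ← mul_assoc, ← integral_const_mul]
    refine integral_congr_ae (Filter.Eventually.of_forall fun w => ?_)
    simp only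
    rw [sub_eq_add_neg, planeWave_add, planeWave_comm x w, planeWave_neg]
    rw [← planeWave_neg w]
    rw [planeWave_neg w]
    ring
  -- the slices
  set g : Config d → 𝓢(Config d, ℂ) := fun b =>
    smulLeftCLM ℂ (compSubConstCLM ℂ ((1 - τ) • b) u) (compSubConstCLM ℂ (-(τ • b)) v) with hg
  have hg_apply : ∀ b s, g b s = u (s - (1 - τ) • b) * v (s + τ • b) := by
    intro b s
    rw [hg]
    simp only
    rw [smulLeftCLM_apply_apply (hasTemperateGrowth _)]
    simp
  set K : 𝓢(PhaseSpace d, ℂ) :=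
    smulLeftCLM ℂ (fun z : PhaseSpace d => planeWave (τ • fst z) (snd z)) (𝓕 Φ) with hK
  have hK_apply : ∀ ζ, K ζ = 𝓕 (g (snd ζ)) (fst ζ) := by
    intro ζ
    rw [hK, smulLeftCLM_apply_apply (chirp_hasTemperateGrowth τ), hA, fourier_coe,
      Real.fourier_eq', smul_eq_mul, ← integral_const_mul,
      ← integral_add_right_eq_self _ (τ • snd ζ)]
    refine integral_congr_ae (Filter.Eventually.of_forall fun s => ?_)
    simp only [hg_apply, smul_eq_mul]
    have e1 : s + τ • snd ζ - snd ζ = s - (1 - τ) • snd ζ := by module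
    rw [e1, ← mul_assoc, mul_comm (v _)]
    congr 1
    simp only [planeWave, ← Complex.exp_add, inner_neg_left, inner_add_left, inner_smul_left]
    congr 1
    rw [real_inner_comm (fst ζ) (snd ζ)]
    simp; ring
  have h2 : wignerAux τ u v z = ∫ y : PhaseSpace d, (fun q : Config d × Config d =>
      planeWave q.1 (fst z) * planeWave q.2 (snd z) * 𝓕 (g q.2) q.1) (fst y, snd y) := by
    change (𝓕⁻ K) z = _
    rw [fourierInv_coe, Real.fourierInv_eq']
    refine integral_congr_ae (Filter.Eventually.of_forall fun y => ?_)
    simp only [hK_apply, smul_eq_mul, inner_eq]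
    congr 1
    simp only [planeWave, ← Complex.exp_add]
    congr 1; push_cast; ring
  have hint : Integrable (fun q : Config d × Config d =>
      planeWave q.1 (fst z) * planeWave q.2 (snd z) * 𝓕 (g q.2) q.1) (volume.prod volume) := by
    refine (integrable_comp_iff _).1 ?_
    refine K.integrable.mono ?_ (Filter.Eventually.of_forall fun y => ?_)
    · have h3 : Continuous fun y : PhaseSpace d => 𝓕 (g (snd y)) (fst y) := by
        have : (fun y : PhaseSpace d => 𝓕 (g (snd y)) (fst y)) = K := by
          funext y; exact (hK_apply y).symm
        rw [this]
        exact K.continuous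
      have := hwave_cont (fun y : PhaseSpace d => fst y) (fun _ => fst z) (by fun_prop)
        (by fun_prop)
      have := hwave_cont (fun y : PhaseSpace d => snd y) (fun _ => snd z) (by fun_prop)
        (by fun_prop)
      exact Continuous.aestronglyMeasurable (by fun_prop)
    · simp [hK_apply]
  rw [h2.trans (integral_eq_prod fun q : Config d × Config d =>
    planeWave q.1 (fst z) * planeWave q.2 (snd z) * 𝓕 (g q.2) q.1), integral_prod_symm _ hint]
  refine integral_congr_ae (Filter.Eventually.of_forall fun t => ?_)
  have hinv : g t (fst z) = ∫ a, planeWave a (fst z) * 𝓕 (g t) a := by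
    exact inversion_apply (g t) _
  simp only
  rw [mul_assoc, ← hg_apply, hinv, ← integral_const_mul]
  refine integral_congr_ae (Filter.Eventually.of_forall fun a => ?_)
  simp only
  ring

/-- The function
`crossWigner τ u v (s, ω) = ∫ e^{2πi⟨t, ω⟩} u(s - (1 - τ) t) v(s + τ t) dt`
on phase space, for Schwartz functions `u` and `v`; it is a Schwartz function. -/
def crossWigner (τ : ℝ) (u v : 𝓢(Config d, ℂ)) : 𝓢(PhaseSpace d, ℂ) where
  toFun z := ∫ t, planeWave t (snd z) * u (fst z - (1 - τ) • t) * v (fst z + τ • t)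
  smooth' := by
    simp only [← wignerAux_apply]
    exact (wignerAux τ u v).smooth'
  decay' := by
    simp only [← wignerAux_apply]
    exact (wignerAux τ u v).decay'

theorem crossWigner_apply (τ : ℝ) (u v : 𝓢(Config d, ℂ)) (z : PhaseSpace d) :
    crossWigner τ u v z =
      ∫ t, planeWave t (snd z) * u (fst z - (1 - τ) • t) * v (fst z + τ • t) := rfl

theorem crossWigner_eq (τ : ℝ) (u v : 𝓢(Config d, ℂ)) :
    crossWigner τ u v = wignerAux τ u v :=
  SchwartzMap.ext fun z => (wignerAux_apply τ u v z).symm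

/-- `crossWigner τ u v` as a continuous linear function of `v`. -/
def crossWignerCLM (τ : ℝ) (u : 𝓢(Config d, ℂ)) : 𝓢(Config d, ℂ) →L[ℂ] 𝓢(PhaseSpace d, ℂ) where
  toFun v := crossWigner τ u v
  map_add' v w := by simp only [crossWigner_eq, map_add]
  map_smul' c v := by simp only [crossWigner_eq, map_smul, RingHom.id_apply]
  cont := by
    simp only [crossWigner_eq]
    exact (wignerAux τ u).continuous

/-- The `τ`-pseudodifferential operator with symbol `p`, applied to a Schwartz function `u`:
`Op_τ(p)u(x) = ∫∫ e^{2πi⟨x - y, ω⟩} p((1 - τ)x + τy, ω) u(y) dy dω`,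
where the integral is understood in the sense of distributions. Testing the right side against
`v(x)` and substituting `s = (1 - τ)x + τy`, `t = x - y` (so `x = s + τt`, `y = s - (1 - τ)t`, with
Jacobian of absolute value one) gives the bilinear pairing `⟨Op_τ(p)u, v⟩ = ⟨p, crossWigner τ u v⟩`,
which makes sense for every tempered distribution `p`. -/
def opTau (τ : ℝ) (p : 𝓢'(PhaseSpace d, ℂ)) (u : 𝓢(Config d, ℂ)) : 𝓢'(Config d, ℂ) :=
  PointwiseConvergenceCLM.precomp ℂ (crossWignerCLM τ u) p

theorem opTau_apply (τ : ℝ) (p : 𝓢'(PhaseSpace d, ℂ)) (u v : 𝓢(Config d, ℂ)) :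
    opTau τ p u v = p (crossWigner τ u v) := rfl

theorem modTrans_apply (z : PhaseSpace d) (u : 𝓢(Config d, ℂ)) (t : Config d) :
    smulLeftCLM ℂ (planeWave (snd z)) (compSubConstCLM ℂ (fst z) u) t =
      planeWave (snd z) t * u (t - fst z) := by
  simp [smulLeftCLM_apply_apply (planeWave_hasTemperateGrowth (snd z))]

/-- The time-frequency shift `π_z = M_ω T_x`, `z = (x, ω)`, that is
`(π_z u)(t) = e^{2πi⟨ω, t⟩} u(t - x)`, on Schwartz functions. -/
def timeFreqShift (z : PhaseSpace d) (u : 𝓢(Config d, ℂ)) : 𝓢(Config d, ℂ) where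
  toFun t := planeWave (snd z) t * u (t - fst z)
  smooth' := by
    simp only [← modTrans_apply]
    exact SchwartzMap.smooth' _
  decay' := by
    simp only [← modTrans_apply]
    exact SchwartzMap.decay' _

/-- The action `z ↦ 𝒥 z` of the matrix `𝒥 = (0, -I; I, 0)` on phase space. -/
def symplecticJ (z : PhaseSpace d) : PhaseSpace d :=
  WithLp.toLp 2 ((Matrix.J (Fin d) ℝ).mulVec z)

end Wigner

section Distributions

variable {E : Type*} [NormedAddCommGroup E] [NormedSpace ℝ E]

/-- Complex-valued test functions `C_0^∞(E)`. -/
abbrev TestFn (E : Type*) [NormedAddCommGroup E] [NormedSpace ℝ E] : Type _ :=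
  𝓓((⊤ : TopologicalSpace.Opens E), ℂ)

/-- The space `𝓓'(E)` of distributions: continuous complex-linear forms on `C_0^∞(E)`. -/
abbrev DistributionOn (E : Type*) [NormedAddCommGroup E] [NormedSpace ℝ E] : Type _ :=
  TestFn E →L[ℂ] ℂ

/-- The test function `x ↦ f (x + a)`. -/
def TestFn.shift (f : TestFn E) (a : E) : TestFn E where
  toFun x := f (x + a)
  contDiff' := f.contDiff.comp (contDiff_id.add contDiff_const)
  hasCompactSupport' := f.hasCompactSupport.comp_homeomorph (Homeomorph.addRight a)
  tsupport_subset' := fun _ _ => trivial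

/-- The test function `x ↦ f x * ψ x`, for a smooth function `ψ`. -/
def TestFn.mulSmooth (f : TestFn E) (ψ : E → ℂ) (hψ : ContDiff ℝ ∞ ψ) : TestFn E where
  toFun x := f x * ψ x
  contDiff' := f.contDiff.mul hψ
  hasCompactSupport' := f.hasCompactSupport.mul_right
  tsupport_subset' := fun _ _ => trivial

/-- A test function regarded as a Schwartz function. -/
def TestFn.toSchwartz (f : TestFn E) : 𝓢(E, ℂ) :=
  f.hasCompactSupport.toSchwartzMap f.contDiff

/-- The tempered distribution `P` is (an extension of) the distribution `p`. -/
def IsTemperedExtension (p : DistributionOn E) (P : 𝓢'(E, ℂ)) : Prop :=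
  ∀ f : TestFn E, P f.toSchwartz = p f

end Distributions

section Lattice

variable {ι : Type*} [Fintype ι] [DecidableEq ι]

/-- The lattice point `L κ`, `κ ∈ ℤⁿ`. -/
def latticePoint (L : GL ι ℝ) (κ : ι → ℤ) : EuclideanSpace ℝ ι :=
  WithLp.toLp 2 ((L : Matrix ι ι ℝ).mulVec fun i => (κ i : ℝ))

/-- The dual lattice point `L⁻ᵀ κ`, `κ ∈ ℤⁿ`. -/
def dualPoint (L : GL ι ℝ) (κ : ι → ℤ) : EuclideanSpace ℝ ι :=
  WithLp.toLp 2 (((L⁻¹ : GL ι ℝ) : Matrix ι ι ℝ).transpose.mulVec fun i => (κ i : ℝ))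

/-- `L`-periodic distributions: `T_{Lκ} p = p` for all `κ ∈ ℤⁿ`, where
`⟨T_a p, f⟩ = ⟨p, f(· + a)⟩`. -/
def IsLatticePeriodic (L : GL ι ℝ) (p : DistributionOn (EuclideanSpace ℝ ι)) : Prop :=
  ∀ (κ : ι → ℤ) (f : TestFn (EuclideanSpace ℝ ι)), p (f.shift (latticePoint L κ)) = p f

/-- The lattice translates of `φ` form a partition of unity: `∑_κ φ(x - Lκ) = 1` for all `x`. -/
def IsLatticePartition (L : GL ι ℝ) (φ : TestFn (EuclideanSpace ℝ ι)) : Prop :=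
  ∀ x, HasSum (fun κ : ι → ℤ => φ (x - latticePoint L κ)) 1

/-- The pairing on the torus `ℝⁿ/Lℤⁿ` of an `L`-periodic distribution `p` with an `L`-periodic smooth
function `ψ`, namely `⟨p, φ ψ⟩`, where `φ` is a test function with `∑_κ φ(· - Lκ) = 1`. -/
def torusPairing (φ : TestFn (EuclideanSpace ℝ ι)) (p : DistributionOn (EuclideanSpace ℝ ι))
    (ψ : EuclideanSpace ℝ ι → ℂ) (hψ : ContDiff ℝ ∞ ψ) : ℂ :=
  p (φ.mulSmooth ψ hψ)

/-- The Fourier coefficient `c_κ(p) = |det L|⁻¹ ⟨p, e^{-2πi⟨L⁻ᵀκ, ·⟩}⟩` of an `L`-periodic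
distribution, the pairing being the one on the torus `ℝⁿ/Lℤⁿ`. -/
def latticeFourierCoeff (L : GL ι ℝ) (φ : TestFn (EuclideanSpace ℝ ι)) (p : DistributionOn (EuclideanSpace ℝ ι))
    (κ : ι → ℤ) : ℂ :=
  ((|(L : Matrix ι ι ℝ).det|⁻¹ : ℝ) : ℂ) *
    torusPairing φ p (planeWave (-dualPoint L κ)) (planeWave_contDiff _)

end Lattice

end TauQuantization

end

open TauQuantization

noncomputable section

namespace TauQuantization

/-! ### Fourier transform of the cross-Wigner function. -/

section Wigner
open PhaseSpace SchwartzMap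
variable {d : ℕ}

/-! A periodic distribution is the sum of its Fourier series, and the quantization of a single plane
wave is a phase times a time-frequency shift; the expansion of the operator is the term-by-term
quantization of the Fourier series of its symbol.

For the second fact, pairing the plane wave of frequency `ξ` with the cross-Wigner function gives
the Fourier transform of that function at `-ξ`. This transform is a chirp, the only place where `τ`
enters, times a short-time Fourier integral of `v` against `u`. At `-ξ` the chirp is the stated
phase and the integral is the matrix element of the shift by `𝒥ξ` (`fourier_crossWigner_neg`).

For the first fact, periodicity and the partition of unity `φ` reduce `p f` to `p` applied to `φ`
times the periodization of `f` (`IsLatticePeriodic.apply_eq_mulSmooth`). By Poisson summation the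
periodization is a trigonometric series over the dual lattice whose coefficients are samples of the
Fourier transform of `f` (`periodization_eq_trigSeries`). As `p` has finite order on the support of
`φ`, it may be applied termwise (`IsRapidlyDecreasing.hasSum_apply_mulSmooth`). Finite order also
bounds the Fourier coefficients polynomially, so the resulting series defines a continuous
functional on all Schwartz functions (`exists_hasSum_mul_apply_neg_dualPoint`). This is the tempered
extension of `p`; it is unique because test functions are dense (`IsTemperedExtension.unique`),
hence its series holds for every choice of `φ`. Evaluating it at the cross-Wigner function of `u`
and `v`, for each `v`, is weak-* convergence of the operator series. -/

theorem continuous_planeWave {X E : Type*} [TopologicalSpace X] [NormedAddCommGroup E]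
    [InnerProductSpace ℝ E] {f g : X → E} (hf : Continuous f) (hg : Continuous g) :
    Continuous fun x => planeWave (f x) (g x) := by
  unfold planeWave
  fun_prop

theorem fourier_chirp_tensorCLM (u v : 𝓢(Config d, ℂ)) (ζ : PhaseSpace d) :
    𝓕 (smulLeftCLM ℂ (fun z : PhaseSpace d => planeWave ((1 : ℝ) • fst z) (snd z))
      (tensorCLM (𝓕 u) v)) ζ = ∫ x, planeWave (-x) (fst ζ) * (v x * u (x - snd ζ)) := by
  set Φ : 𝓢(PhaseSpace d, ℂ) :=
    smulLeftCLM ℂ (fun z : PhaseSpace d => planeWave ((1 : ℝ) • fst z) (snd z))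
      (tensorCLM (𝓕 u) v) with hΦ
  have hΦ_apply : ∀ z, Φ z = planeWave (fst z) (snd z) * (v (fst z) * 𝓕 u (snd z)) := by
    intro z
    rw [hΦ, smulLeftCLM_apply_apply (chirp_hasTemperateGrowth 1)]
    simp
  have h1 : 𝓕 Φ ζ = ∫ y : PhaseSpace d, (fun q : Config d × Config d =>
      planeWave (-q.1) (fst ζ) * planeWave (-q.2) (snd ζ) *
        (planeWave q.1 q.2 * (v q.1 * 𝓕 u q.2))) (fst y, snd y) := by
    rw [fourier_coe, Real.fourier_eq']
    refine integral_congr_ae (Filter.Eventually.of_forall fun y => ?_)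
    simp only [hΦ_apply, smul_eq_mul, inner_eq]
    congr 1
    simp only [planeWave, ← Complex.exp_add, inner_neg_left]
    congr 1; push_cast; ring
  have hint : Integrable (fun q : Config d × Config d =>
      planeWave (-q.1) (fst ζ) * planeWave (-q.2) (snd ζ) *
        (planeWave q.1 q.2 * (v q.1 * 𝓕 u q.2))) (volume.prod volume) := by
    refine (integrable_comp_iff _).1 ?_
    refine Φ.integrable.mono ?_ (Filter.Eventually.of_forall fun y => ?_)
    · refine Continuous.aestronglyMeasurable ?_
      have := continuous_planeWave (f := fun z : PhaseSpace d => -fst z) (g := fun _ => fst ζ)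
        (by fun_prop) (by fun_prop)
      have := continuous_planeWave (f := fun z : PhaseSpace d => -snd z) (g := fun _ => snd ζ)
        (by fun_prop) (by fun_prop)
      have := continuous_planeWave (f := fun z : PhaseSpace d => fst z) (g := fun z => snd z)
        (by fun_prop) (by fun_prop)
      fun_prop
    · simp [hΦ_apply]
  rw [h1.trans (integral_eq_prod fun q : Config d × Config d =>
      planeWave (-q.1) (fst ζ) * planeWave (-q.2) (snd ζ) *
        (planeWave q.1 q.2 * (v q.1 * 𝓕 u q.2))), integral_prod _ hint]
  refine integral_congr_ae (Filter.Eventually.of_forall fun x => ?_)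
  simp only
  -- After Fubini, the integral over the frequency variable is Fourier inversion for `u` at `x - snd
  -- ζ`.
  rw [inversion_apply u (x - snd ζ), ← mul_assoc, ← integral_const_mul]
  refine integral_congr_ae (Filter.Eventually.of_forall fun w => ?_)
  simp only
  rw [sub_eq_add_neg, planeWave_add, planeWave_comm x w, planeWave_neg, ← planeWave_neg w,
    planeWave_neg w]
  ring

/-- The cross-Wigner function is an inverse Fourier transform of a chirp times a Fourier transform,
so the outer transform merely cancels. -/
theorem fourier_crossWigner (τ : ℝ) (u v : 𝓢(Config d, ℂ)) (ζ : PhaseSpace d) :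
    𝓕 (crossWigner τ u v) ζ = planeWave (τ • fst ζ) (snd ζ) *
      ∫ x, planeWave (-x) (fst ζ) * (v x * u (x - snd ζ)) := by
  rw [crossWigner_eq, ← fourier_chirp_tensorCLM, ← smul_eq_mul,
    ← smulLeftCLM_apply_apply (chirp_hasTemperateGrowth τ)]
  exact congrArg (fun K : 𝓢(PhaseSpace d, ℂ) => K ζ)
    (FourierTransform.fourier_fourierInv_eq (smulLeftCLM ℂ
      (fun z : PhaseSpace d => planeWave (τ • fst z) (snd z)) _))

theorem fst_symplecticJ (z : PhaseSpace d) : fst (symplecticJ z) = -snd z := by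
  ext i
  simp [symplecticJ, Matrix.J, Matrix.mulVec, dotProduct, Matrix.fromBlocks, Matrix.one_apply]

theorem snd_symplecticJ (z : PhaseSpace d) : snd (symplecticJ z) = fst z := by
  ext i
  simp [symplecticJ, Matrix.J, Matrix.mulVec, dotProduct, Matrix.fromBlocks, Matrix.one_apply]

/-- The matrix element of a plane-wave symbol is that of a time-frequency shift. -/
theorem fourier_crossWigner_neg (τ : ℝ) (u v : 𝓢(Config d, ℂ)) (ξ : PhaseSpace d) :
    𝓕 (crossWigner τ u v) (-ξ) =
      Complex.exp (2 * Real.pi * Complex.I * τ * (inner ℝ (snd ξ) (fst ξ) : ℝ)) *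
        (timeFreqShift (symplecticJ ξ) u : 𝓢'(Config d, ℂ)) v := by
  rw [fourier_crossWigner, SchwartzMap.coe_apply]
  congr 1
  -- The chirp is quadratic, so the two signs coming from `-ξ` cancel.
  · rw [planeWave]
    congr 1
    simp only [map_neg, smul_neg, inner_neg_left, inner_neg_right, inner_smul_left, neg_neg]
    rw [real_inner_comm]
    simp
    ring
  -- Since `𝒥(x, ω) = (-ω, x)`, evaluation at `-ξ` turns the translation by `snd ζ` into that of the
  -- shift by `𝒥ξ`.
  · refine integral_congr_ae (Filter.Eventually.of_forall fun x => ?_)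
    change _ = v x • (planeWave (snd (symplecticJ ξ)) x * u (x - fst (symplecticJ ξ)))
    rw [fst_symplecticJ, snd_symplecticJ, planeWave_comm (fst ξ) x, smul_eq_mul]
    simp only [map_neg, sub_neg_eq_add]
    rw [planeWave_neg, neg_neg]
    ring

end Wigner

open Filter Topology

/-! ### Density of test functions in Schwartz space and uniqueness of tempered extensions. -/

section Density

variable {E : Type*} [NormedAddCommGroup E] [NormedSpace ℝ E]

@[simp] theorem TestFn.toSchwartz_apply (f : TestFn E) (x : E) : f.toSchwartz x = f x := rfl

@[simp] theorem TestFn.mulSmooth_apply (f : TestFn E) (ψ : E → ℂ) (hψ : ContDiff ℝ ∞ ψ) (x : E) :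
    f.mulSmooth ψ hψ x = f x * ψ x := rfl

@[simp] theorem TestFn.shift_apply (f : TestFn E) (a x : E) : f.shift a x = f (x + a) := rfl

/-- The test function `x ↦ f (r x)`, for `r ≠ 0`. -/
def TestFn.dilate (f : TestFn E) (r : ℝ) (hr : r ≠ 0) : TestFn E where
  toFun x := f (r • x)
  contDiff' := f.contDiff.comp (contDiff_const_smul r)
  hasCompactSupport' := f.hasCompactSupport.comp_homeomorph (Homeomorph.smulOfNeZero r hr)
  tsupport_subset' := fun _ _ => trivial

@[simp] theorem TestFn.dilate_apply (f : TestFn E) (r : ℝ) (hr : r ≠ 0) (x : E) :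
    f.dilate r hr x = f (r • x) := rfl

theorem TestFn.exists_bound_iteratedFDeriv (f : TestFn E) (n : ℕ) :
    ∃ C, 0 ≤ C ∧ ∀ x, ‖iteratedFDeriv ℝ n f x‖ ≤ C :=
  ⟨SchwartzMap.seminorm ℂ 0 n f.toSchwartz, by positivity, fun x =>
    SchwartzMap.norm_iteratedFDeriv_le_seminorm ℂ f.toSchwartz n x⟩

theorem exists_testFn_eq_one_near_zero [FiniteDimensional ℝ E] :
    ∃ χ : TestFn E, ∀ x, ‖x‖ < 1 → χ x = 1 := by
  let b : ContDiffBump (0 : E) := ⟨1, 2, by norm_num, by norm_num⟩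
  refine ⟨⟨fun x => (b x : ℂ), Complex.ofRealCLM.contDiff.comp b.contDiff, ?_, fun _ _ => trivial⟩,
    fun x hx => ?_⟩
  · exact b.hasCompactSupport.comp_left (g := fun y : ℝ => (y : ℂ)) Complex.ofReal_zero
  · change ((b x : ℝ) : ℂ) = 1
    rw [b.one_of_mem_closedBall (by simpa using hx.le)]
    simp

/-- Each derivative of the dilate brings out a factor `r`, harmless for `|r| ≤ 1`. The point is that
the bound is uniform in `r`. -/
theorem norm_iteratedFDeriv_one_sub_dilate_le (χ : TestFn E) (n : ℕ) :
    ∃ C, 0 ≤ C ∧ ∀ (r : ℝ) (hr : r ≠ 0), |r| ≤ 1 → ∀ x,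
      ‖iteratedFDeriv ℝ n (fun x => 1 - χ.dilate r hr x) x‖ ≤ C := by
  obtain ⟨C, hC, h⟩ := χ.exists_bound_iteratedFDeriv n
  refine ⟨1 + C, by positivity, fun r hr hr1 x => ?_⟩
  have h2 : ‖iteratedFDeriv ℝ n (fun x => χ (r • x)) x‖ ≤ C := by
    have e := iteratedFDeriv_comp_const_smul (𝕜 := ℝ) (i := n) (f := χ) r
      (χ.contDiff.of_le (m := n) (by exact_mod_cast le_top))
    rw [congrFun e x, norm_smul]
    refine (mul_le_of_le_one_left (norm_nonneg _) ?_).trans (h _)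
    rw [norm_pow]
    exact pow_le_one₀ (norm_nonneg _) hr1
  change ‖iteratedFDeriv ℝ n ((fun _ => (1 : ℂ)) - ⇑(χ.dilate r hr)) x‖ ≤ _
  rw [iteratedFDeriv_sub_apply contDiff_const.contDiffAt
    ((χ.dilate r hr).contDiff.of_le (by exact_mod_cast le_top)).contDiffAt]
  refine (norm_sub_le _ _).trans (add_le_add ?_ h2)
  rcases n with _ | n
  · simp
  · simp [iteratedFDeriv_const_of_ne]

/-- The error of the cutoff at scale `m + 1` lives where `‖x‖ ≥ m + 1`; there one extra power of
`‖x‖` in the seminorm is traded for a factor `1 / (m + 1)`. -/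
theorem tendsto_dilate_mulSmooth_toSchwartz (χ : TestFn E) (hχ : ∀ x, ‖x‖ < 1 → χ x = 1)
    (f : 𝓢(E, ℂ)) :
    Tendsto (fun m : ℕ => ((χ.dilate ((m + 1 : ℝ)⁻¹) (by positivity)).mulSmooth f
      (f.smooth ⊤)).toSchwartz) atTop (𝓝 f) := by
  rw [(schwartz_withSeminorms ℂ E ℂ).tendsto_nhds]
  rintro ⟨k, n⟩ ε hε
  choose C hC0 hC using norm_iteratedFDeriv_one_sub_dilate_le χ
  -- The Leibniz constant, with weight `k + 1` in place of `k` to pay for that trade.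
  set A : ℝ := ∑ i ∈ Finset.range (n + 1), (n.choose i : ℝ) * C i *
    SchwartzMap.seminorm ℂ (k + 1) (n - i) f with hA
  have hA0 : 0 ≤ A := Finset.sum_nonneg fun i _ =>
    mul_nonneg (mul_nonneg (Nat.cast_nonneg _) (hC0 i)) (by positivity)
  have key : ∀ m : ℕ, SchwartzMap.seminorm ℂ k n (((χ.dilate ((m + 1 : ℝ)⁻¹)
      (by positivity)).mulSmooth f (f.smooth ⊤)).toSchwartz - f) ≤ A * (1 / ((m : ℝ) + 1)) := by
    intro m
    have hm : (0 : ℝ) < m + 1 := by positivity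
    have hr : ((m + 1 : ℝ)⁻¹) ≠ 0 := by positivity
    refine SchwartzMap.seminorm_le_bound ℂ k n _ (by positivity) fun x => ?_
    set h : E → ℂ := fun x => 1 - χ.dilate ((m + 1 : ℝ)⁻¹) hr x with hh
    have hhs : ContDiff ℝ ∞ h := contDiff_const.sub (χ.dilate _ hr).contDiff
    have e : ⇑(((χ.dilate ((m + 1 : ℝ)⁻¹) hr).mulSmooth f (f.smooth ⊤)).toSchwartz - f) =
        -(fun x => h x * f x) := by
      funext y
      simp [hh]
      ring
    rw [e, iteratedFDeriv_neg, Pi.neg_apply, norm_neg]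
    by_cases hx : ‖x‖ < m + 1
    · have hz : (fun x => h x * f x) =ᶠ[𝓝 x] fun _ => 0 := by
        filter_upwards [continuous_norm.continuousAt.eventually_lt continuousAt_const hx] with y hy
        have : χ (((m + 1 : ℝ)⁻¹) • y) = 1 := by
          apply hχ
          rw [norm_smul, norm_inv, Real.norm_of_nonneg hm.le, inv_mul_lt_iff₀ hm]
          simpa using hy
        simp [hh, this]
      have : iteratedFDeriv ℝ n (fun x => h x * f x) x = 0 := by
        rw [(hz.iteratedFDeriv ℝ n).eq_of_nhds]
        exact congrFun (iteratedFDeriv_fun_zero) x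
      rw [this]
      simp only [norm_zero, mul_zero]
      positivity
    · push Not at hx
      have hr1 : |((m + 1 : ℝ)⁻¹)| ≤ 1 := by
        rw [abs_of_pos (by positivity)]
        exact inv_le_one_of_one_le₀ (by linarith [Nat.cast_nonneg (α := ℝ) m])
      have h1 : 1 ≤ ‖x‖ * (1 / ((m : ℝ) + 1)) := by
        rw [mul_one_div, le_div_iff₀ hm]; linarith
      have hmul := norm_iteratedFDeriv_mul_le (𝕜 := ℝ) (n := n) (N := ∞) hhs (f.smooth ⊤) x
        (by exact_mod_cast le_top)
      calc ‖x‖ ^ k * ‖iteratedFDeriv ℝ n (fun x => h x * f x) x‖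
          ≤ ‖x‖ ^ k * (‖x‖ * (1 / ((m : ℝ) + 1))) * ∑ i ∈ Finset.range (n + 1), (n.choose i : ℝ) *
            ‖iteratedFDeriv ℝ i h x‖ * ‖iteratedFDeriv ℝ (n - i) f x‖ := by
            gcongr
            exact le_mul_of_one_le_right (by positivity) h1
        _ = (∑ i ∈ Finset.range (n + 1), (n.choose i : ℝ) *
            ‖iteratedFDeriv ℝ i h x‖ * (‖x‖ ^ (k + 1) * ‖iteratedFDeriv ℝ (n - i) f x‖)) *
              (1 / ((m : ℝ) + 1)) := by
            rw [Finset.mul_sum, Finset.sum_mul]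
            exact Finset.sum_congr rfl fun i _ => by ring
        _ ≤ A * (1 / ((m : ℝ) + 1)) := by
            rw [hA]
            gcongr with i _
            · exact mul_nonneg (Nat.cast_nonneg _) (hC0 i)
            · exact hC i _ hr hr1 x
            · exact f.le_seminorm ℂ (k + 1) (n - i) x
  have hlim : Tendsto (fun m : ℕ => A * (1 / ((m : ℝ) + 1))) atTop (𝓝 (A * 0)) :=
    tendsto_one_div_add_atTop_nhds_zero_nat.const_mul A
  rw [mul_zero] at hlim
  filter_upwards [hlim.eventually (gt_mem_nhds hε)] with m hm
  exact (key m).trans_lt hm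

/-- A tempered distribution is determined by its values on test functions. -/
theorem IsTemperedExtension.unique [FiniteDimensional ℝ E] {p : DistributionOn E} {P Q : 𝓢'(E, ℂ)}
    (hP : IsTemperedExtension p P) (hQ : IsTemperedExtension p Q) : P = Q := by
  obtain ⟨χ, hχ⟩ := exists_testFn_eq_one_near_zero (E := E)
  ext f
  have h := tendsto_dilate_mulSmooth_toSchwartz χ hχ f
  have h1 := (ContinuousLinearMap.continuous P).tendsto f |>.comp h
  have h2 := (ContinuousLinearMap.continuous Q).tendsto f |>.comp h
  refine tendsto_nhds_unique h1 (h2.congr fun m => ?_)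
  simp only [Function.comp_apply]
  exact (hQ _).trans (hP _).symm

end Density

/-! ### Lattices, dual lattices and counting estimates. -/

section Lattice
variable {ι : Type*} [Fintype ι] [DecidableEq ι]

/-- A matrix in `GL` as an automorphism of Euclidean space. -/
def matrixEquiv (M : GL ι ℝ) : EuclideanSpace ℝ ι ≃L[ℝ] EuclideanSpace ℝ ι :=
  LinearEquiv.toContinuousLinearEquiv
    { toFun := fun x => WithLp.toLp 2 ((M : Matrix ι ι ℝ).mulVec x.ofLp)
      map_add' := fun x y => by simp [Matrix.mulVec_add]
      map_smul' := fun c x => by simp [Matrix.mulVec_smul]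
      invFun := fun x => WithLp.toLp 2 (((M⁻¹ : GL ι ℝ) : Matrix ι ι ℝ).mulVec x.ofLp)
      left_inv := fun x => by simp [Matrix.mulVec_mulVec]
      right_inv := fun x => by simp [Matrix.mulVec_mulVec] }

theorem matrixEquiv_apply (M : GL ι ℝ) (x : EuclideanSpace ℝ ι) :
    matrixEquiv M x = WithLp.toLp 2 ((M : Matrix ι ι ℝ).mulVec x.ofLp) := rfl

/-- An integer vector as a point of Euclidean space. -/
def intVec (κ : ι → ℤ) : EuclideanSpace ℝ ι := WithLp.toLp 2 fun i => (κ i : ℝ)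

@[simp] theorem intVec_apply (κ : ι → ℤ) (i : ι) : intVec κ i = κ i := rfl

theorem latticePoint_eq (L : GL ι ℝ) (κ : ι → ℤ) :
    latticePoint L κ = matrixEquiv L (intVec κ) := rfl

/-- The transposed inverse of an invertible matrix. -/
def dualGL (L : GL ι ℝ) : GL ι ℝ where
  val := ((L⁻¹ : GL ι ℝ) : Matrix ι ι ℝ).transpose
  inv := (L : Matrix ι ι ℝ).transpose
  val_inv := by rw [← Matrix.transpose_mul, ← Units.val_mul]; simp
  inv_val := by rw [← Matrix.transpose_mul, ← Units.val_mul]; simp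

theorem dualPoint_eq (L : GL ι ℝ) (κ : ι → ℤ) :
    dualPoint L κ = matrixEquiv (dualGL L) (intVec κ) := rfl

/-- `L⁻ᵀ` is adjoint to `L⁻¹`, which cancels `L`. For integral `x` the pairing is an integer, which
makes dual plane waves lattice-periodic. -/
theorem inner_dualPoint (L : GL ι ℝ) (κ : ι → ℤ) (x : EuclideanSpace ℝ ι) :
    inner ℝ (dualPoint L κ) (matrixEquiv L x) = ∑ i, (κ i : ℝ) * x i := by
  have h : ((L⁻¹ : GL ι ℝ) : Matrix ι ι ℝ) * (L : Matrix ι ι ℝ) = 1 := by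
    rw [← Units.val_mul]; simp
  rw [EuclideanSpace.inner_eq_star_dotProduct]
  simp only [dualPoint, matrixEquiv_apply, star_trivial]
  rw [dotProduct_comm]
  rw [Matrix.mulVec_transpose, ← Matrix.dotProduct_mulVec, Matrix.mulVec_mulVec, h,
    Matrix.one_mulVec]
  rfl

theorem dualPoint_neg (L : GL ι ℝ) (κ : ι → ℤ) : dualPoint L (-κ) = -dualPoint L κ := by
  rw [dualPoint_eq, dualPoint_eq, ← map_neg]
  congr 1
  ext i; simp

theorem latticePoint_add (L : GL ι ℝ) (κ μ : ι → ℤ) :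
    latticePoint L (κ + μ) = latticePoint L κ + latticePoint L μ := by
  simp only [latticePoint_eq, ← map_add]
  congr 1
  ext i; simp

theorem latticePoint_neg (L : GL ι ℝ) (κ : ι → ℤ) :
    latticePoint L (-κ) = -latticePoint L κ := by
  simp only [latticePoint_eq, ← map_neg]
  congr 1
  ext i; simp

/-- Apply `M⁻¹` to `Mκ`; the sup norm is at most the Euclidean one. This transfers finiteness and
summability from `ℤⁿ` to any lattice. -/
theorem norm_int_le (M : GL ι ℝ) (κ : ι → ℤ) :
    ‖κ‖ ≤ ‖((matrixEquiv M).symm : EuclideanSpace ℝ ι →L[ℝ] EuclideanSpace ℝ ι)‖ *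
      ‖matrixEquiv M (intVec κ)‖ := by
  have h1 : ‖κ‖ ≤ ‖intVec κ‖ := by
    refine (pi_norm_le_iff_of_nonneg (norm_nonneg _)).2 fun i => ?_
    have := PiLp.norm_apply_le (intVec κ) i
    simpa [Int.norm_eq_abs] using this
  refine h1.trans ?_
  have := ContinuousLinearMap.le_opNorm
    ((matrixEquiv M).symm : EuclideanSpace ℝ ι →L[ℝ] EuclideanSpace ℝ ι) (matrixEquiv M (intVec κ))
  simpa using this

/-- Only finitely many lattice translations move a compact set so as to meet another one. -/
theorem finite_setOf_add_latticePoint_mem (L : GL ι ℝ) {K K' : Set (EuclideanSpace ℝ ι)}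
    (hK : IsCompact K) (hK' : IsCompact K') :
    {κ : ι → ℤ | ∃ x ∈ K, x + latticePoint L κ ∈ K'}.Finite := by
  obtain ⟨R, hR⟩ := hK.isBounded.exists_norm_le
  obtain ⟨R', hR'⟩ := hK'.isBounded.exists_norm_le
  set C := ‖((matrixEquiv L).symm : EuclideanSpace ℝ ι →L[ℝ] EuclideanSpace ℝ ι)‖
  refine (isCompact_iff_finite.1 (isCompact_closedBall (0 : ι → ℤ) (C * (R + R')))).subset ?_
  rintro κ ⟨x, hx, hx'⟩
  rw [mem_closedBall_zero_iff]
  refine (norm_int_le L κ).trans (mul_le_mul_of_nonneg_left ?_ (norm_nonneg _))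
  have : matrixEquiv L (intVec κ) = (x + latticePoint L κ) - x := by rw [latticePoint_eq]; abel
  rw [this]
  exact (norm_sub_le _ _).trans (by linarith [hR x hx, hR' _ hx'])

/-- Comparison with `∑ ‖κ‖⁻ⁿ` over the standard lattice, which converges once `n` exceeds the rank.
-/
theorem summable_one_add_norm_pow_inv (M : GL ι ℝ) {n : ℕ} (hn : Fintype.card ι < n) :
    Summable fun κ : ι → ℤ => ((1 + ‖matrixEquiv M (intVec κ)‖) ^ n)⁻¹ := by
  let b := Pi.basisFun ℝ ι
  let Λ : Submodule ℤ (ι → ℝ) := Submodule.span ℤ (Set.range b)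
  have hrank : Module.finrank ℤ Λ < n := by
    rw [Module.finrank_eq_card_basis (b.restrictScalars ℤ)]
    exact hn
  have h := ZLattice.summable_norm_pow_inv Λ n hrank
  have h2 := (b.restrictScalars ℤ).equivFun.symm.toEquiv.summable_iff.2 h
  have hnorm : ∀ κ : ι → ℤ, ‖((b.restrictScalars ℤ).equivFun.symm κ : Λ)‖ = ‖κ‖ := by
    intro κ
    have : (((b.restrictScalars ℤ).equivFun.symm κ : Λ) : ι → ℝ) = fun i => (κ i : ℝ) := by
      rw [Module.Basis.equivFun_symm_apply]
      funext j
      simp [b, Pi.single_apply]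
    rw [Submodule.coe_norm, this]
    simp [Pi.norm_def]
    rfl
  set C := ‖((matrixEquiv M).symm : EuclideanSpace ℝ ι →L[ℝ] EuclideanSpace ℝ ι)‖
  have h3 : Summable fun κ : ι → ℤ => (C + 1) ^ n * (‖κ‖ ^ n)⁻¹ := by
    refine Summable.mul_left _ (h2.congr fun κ => ?_)
    simp only [Function.comp_apply]
    rw [← hnorm κ]
    simp
  -- The comparison follows from `‖κ‖ ≤ (C + 1)(1 + ‖Mκ‖)`. It fails at `κ = 0`, where the inverse
  -- of zero is zero by convention, so that index is discarded.
  have h4 : ∀ᶠ κ : ι → ℤ in cofinite, ‖((1 + ‖matrixEquiv M (intVec κ)‖) ^ n)⁻¹‖ ≤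
      (C + 1) ^ n * (‖κ‖ ^ n)⁻¹ := by
    filter_upwards [(Set.finite_singleton (0 : ι → ℤ)).compl_mem_cofinite] with κ hκ
    have hpos : 0 < ‖κ‖ := norm_pos_iff.2 hκ
    have hC : 0 ≤ C := norm_nonneg _
    rw [norm_inv, norm_pow, Real.norm_of_nonneg (by positivity), ← inv_pow, ← inv_pow, ← mul_pow]
    refine pow_le_pow_left₀ (by positivity) ?_ n
    rw [← div_eq_mul_inv, inv_le_comm₀ (by positivity) (by positivity), inv_div,
      div_le_iff₀ (by positivity)]
    have := norm_int_le M κ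
    nlinarith [norm_nonneg (matrixEquiv M (intVec κ))]
  exact h3.of_norm_bounded_eventually h4

/-! ### Partitions of unity -/

/-- A compactly supported smooth step whose integer translates sum to one. -/
def unitStep (t : ℝ) : ℝ := Real.smoothTransition (t + 1) - Real.smoothTransition t

theorem unitStep_eq_zero {t : ℝ} (ht : 1 ≤ |t|) : unitStep t = 0 := by
  rcases le_abs.1 ht with h | h
  · rw [unitStep, Real.smoothTransition.one_of_one_le (by linarith),
      Real.smoothTransition.one_of_one_le h, sub_self]
  · rw [unitStep, Real.smoothTransition.zero_of_nonpos (by linarith),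
      Real.smoothTransition.zero_of_nonpos (by linarith), sub_self]

theorem contDiff_unitStep : ContDiff ℝ ∞ unitStep :=
  (Real.smoothTransition.contDiff.comp (contDiff_id.add contDiff_const)).sub
    Real.smoothTransition.contDiff

/-- The sum telescopes to the smooth transition at `t + 1` minus that at `t - 1`, where it is
already constant. -/
theorem unitStep_add (t : ℝ) (h0 : 0 ≤ t) (h1 : t < 1) : unitStep t + unitStep (t - 1) = 1 := by
  simp only [unitStep, sub_add_cancel]
  rw [Real.smoothTransition.one_of_one_le (x := t + 1) (by linarith),
    Real.smoothTransition.zero_of_nonpos (x := t - 1) (by linarith)]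
  ring

theorem sum_unitStep_floor (t : ℝ) :
    ∑ k ∈ {⌊t⌋, ⌊t⌋ + 1}, unitStep (t - (k : ℤ)) = 1 := by
  rw [Finset.sum_pair (by simp)]
  have := unitStep_add (t - ⌊t⌋) (by linarith [Int.floor_le t]) (by linarith [Int.lt_floor_add_one t])
  rw [← this]
  push_cast
  ring_nf

theorem unitStep_sub_eq_zero {t : ℝ} {k : ℤ} (hk : k ∉ ({⌊t⌋, ⌊t⌋ + 1} : Finset ℤ)) :
    unitStep (t - k) = 0 := by
  simp only [Finset.mem_insert, Finset.mem_singleton, not_or] at hk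
  apply unitStep_eq_zero
  rw [le_abs]
  rcases lt_or_gt_of_ne hk.1 with h | h
  · left
    have : (k : ℝ) + 1 ≤ ⌊t⌋ := by exact_mod_cast h
    linarith [Int.floor_le t]
  · right
    have : (⌊t⌋ : ℝ) + 2 ≤ k := by
      have : ⌊t⌋ + 2 ≤ k := by omega
      exact_mod_cast this
    linarith [Int.lt_floor_add_one t]

/-- Two integers per coordinate contribute, and the finite sum of products factors into
one-dimensional sums, each equal to one. -/
theorem hasSum_prod_unitStep (y : ι → ℝ) :
    HasSum (fun κ : ι → ℤ => ∏ i, unitStep (y i - κ i)) 1 := by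
  have h := hasSum_sum_of_ne_finset_zero (L := SummationFilter.unconditional _) (f := fun κ : ι → ℤ => ∏ i, unitStep (y i - κ i))
    (s := Fintype.piFinset fun i => {⌊y i⌋, ⌊y i⌋ + 1}) fun κ hκ => by
      simp only [Fintype.mem_piFinset, not_forall] at hκ
      obtain ⟨i, hi⟩ := hκ
      exact Finset.prod_eq_zero (Finset.mem_univ i) (unitStep_sub_eq_zero hi)
  rwa [← Finset.prod_univ_sum (fun i => {⌊y i⌋, ⌊y i⌋ + 1}) fun i (k : ℤ) => unitStep (y i - k),
    Finset.prod_congr rfl fun i _ => sum_unitStep_floor (y i), Finset.prod_const_one] at h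

/-- Pulling back by `L⁻¹` turns lattice translations into integer ones, so a product of unit steps
in the coordinates works. -/
theorem exists_isLatticePartition (L : GL ι ℝ) :
    ∃ φ : TestFn (EuclideanSpace ℝ ι), IsLatticePartition L φ := by
  let g : EuclideanSpace ℝ ι → ℝ := fun x => ∏ i, unitStep ((matrixEquiv L).symm x i)
  have hg : ContDiff ℝ ∞ g := by
    refine contDiff_prod fun i _ => contDiff_unitStep.comp ?_
    exact ((EuclideanSpace.proj i : EuclideanSpace ℝ ι →L[ℝ] ℝ).comp
      ((matrixEquiv L).symm : EuclideanSpace ℝ ι →L[ℝ] EuclideanSpace ℝ ι)).contDiff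
  have hsupp : HasCompactSupport g := by
    have hK : IsCompact {y : EuclideanSpace ℝ ι | ∀ i, y i ∈ Set.Icc (-1 : ℝ) 1} := by
      have := (isCompact_univ_pi fun _ : ι => isCompact_Icc (a := (-1 : ℝ)) (b := 1)).image
        (PiLp.continuous_toLp 2 fun _ : ι => ℝ)
      convert this using 1
      ext y
      constructor
      · exact fun hy => ⟨y.ofLp, fun i _ => hy i, rfl⟩
      · rintro ⟨z, hz, rfl⟩ i
        exact hz i trivial
    refine HasCompactSupport.intro (hK.image (matrixEquiv L).continuous) fun x hx => ?_
    by_contra hne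
    refine hx ⟨(matrixEquiv L).symm x, fun i => ?_, by simp⟩
    by_contra hi
    refine hne (Finset.prod_eq_zero (Finset.mem_univ i) (unitStep_eq_zero ?_))
    rw [Set.mem_Icc, ← abs_le, not_le] at hi
    exact hi.le
  refine ⟨⟨fun x => (g x : ℂ), Complex.ofRealCLM.contDiff.comp hg,
    hsupp.comp_left (g := fun y : ℝ => (y : ℂ)) Complex.ofReal_zero, fun _ _ => trivial⟩,
    fun x => ?_⟩
  have h := (hasSum_prod_unitStep ((matrixEquiv L).symm x).ofLp).mapL Complex.ofRealCLM
  simp only [Complex.ofRealCLM_apply, Complex.ofReal_one] at h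
  refine h.congr_fun fun κ => ?_
  change ((∏ i, unitStep ((matrixEquiv L).symm (x - latticePoint L κ) i) : ℝ) : ℂ) = _
  simp [latticePoint_eq]

end Lattice

/-! ### Finite order of distributions on compact sets. -/

section FiniteOrder

variable {E : Type*} [NormedAddCommGroup E] [NormedSpace ℝ E]

/-- A distribution has finite order on the support of a test function. -/
theorem exists_norm_apply_mulSmooth_le (p : DistributionOn E) (φ : TestFn E) :
    ∃ (N : ℕ) (C : ℝ), 0 ≤ C ∧ ∀ (ψ : E → ℂ) (hψ : ContDiff ℝ ∞ ψ) (M : ℝ), 0 ≤ M →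
      (∀ i ≤ N, ∀ x, ‖iteratedFDeriv ℝ i ψ x‖ ≤ M) → ‖p (φ.mulSmooth ψ hψ)‖ ≤ C * M := by
  -- On functions supported in the fixed compact set `K` the topology is given by countably many
  -- seminorms, so continuity of `p` there yields a bound by finitely many of them.
  let K : TopologicalSpace.Compacts E := ⟨tsupport φ, φ.hasCompactSupport⟩
  have hK : (K : Set E) ⊆ (⊤ : TopologicalSpace.Opens E) := fun _ _ => trivial
  let q : 𝓓_{K}(E, ℂ) →L[ℂ] ℂ := p.comp (TestFunction.ofSupportedInCLM ℂ hK)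
  obtain ⟨s, C, -, hC⟩ := Seminorm.bound_of_continuous
    (ContDiffMapSupportedIn.withSeminorms ℂ E ℂ ⊤ K)
    ((normSeminorm ℂ ℂ).comp q.toLinearMap) (continuous_norm.comp q.continuous)
  choose B hB0 hB using φ.exists_bound_iteratedFDeriv
  -- `N` is the highest order among these seminorms; `D` collects the Leibniz constants for
  -- multiplication by `φ` at all orders up to `N`.
  set N := s.sup id with hN
  set D : ℝ := ∑ n ∈ Finset.range (N + 1), ∑ i ∈ Finset.range (n + 1), (n.choose i : ℝ) * B i
    with hD
  have hD0 : 0 ≤ D := Finset.sum_nonneg fun n _ => Finset.sum_nonneg fun i _ =>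
    mul_nonneg (Nat.cast_nonneg _) (hB0 i)
  refine ⟨N, C * D, by positivity, fun ψ hψ M hM h => ?_⟩
  let g : 𝓓_{K}(E, ℂ) := ⟨φ.mulSmooth ψ hψ, (φ.mulSmooth ψ hψ).contDiff, fun x hx => by
    have : φ x = 0 := image_eq_zero_of_notMem_tsupport hx
    simp [this]⟩
  have hq : q g = p (φ.mulSmooth ψ hψ) := rfl
  have h1 := hC g
  rw [← hq]
  refine h1.trans ?_
  rw [smul_apply, NNReal.smul_def, smul_eq_mul, mul_assoc]
  refine mul_le_mul_of_nonneg_left ?_ C.2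
  refine Seminorm.finset_sup_apply_le (by positivity) fun n hn => ?_
  rw [ContDiffMapSupportedIn.seminorm_le_iff ℂ (by positivity)]
  intro _ x _
  have hnN : n ≤ N := Finset.le_sup (f := id) hn
  have hmul := norm_iteratedFDeriv_mul_le (𝕜 := ℝ) (n := n) (N := ∞) φ.contDiff hψ x
    (by exact_mod_cast le_top)
  calc ‖iteratedFDeriv ℝ n (fun x => φ x * ψ x) x‖
      ≤ ∑ i ∈ Finset.range (n + 1), (n.choose i : ℝ) * ‖iteratedFDeriv ℝ i φ x‖ *
        ‖iteratedFDeriv ℝ (n - i) ψ x‖ := hmul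
    _ ≤ ∑ i ∈ Finset.range (n + 1), (n.choose i : ℝ) * B i * M := by
        gcongr with i _
        · exact mul_nonneg (Nat.cast_nonneg _) (hB0 i)
        · exact hB i x
        · exact h _ (by omega) x
    _ = (∑ i ∈ Finset.range (n + 1), (n.choose i : ℝ) * B i) * M := by rw [Finset.sum_mul]
    _ ≤ D * M := by
        gcongr
        exact Finset.single_le_sum (f := fun n => ∑ i ∈ Finset.range (n + 1), (n.choose i : ℝ) * B i)
          (fun n _ => Finset.sum_nonneg fun i _ => mul_nonneg (Nat.cast_nonneg _) (hB0 i))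
          (Finset.mem_range.2 (Nat.lt_succ_of_le hnN))

end FiniteOrder

/-! ### Trigonometric series with rapidly decreasing coefficients. -/

section TrigSeries

variable {E : Type*} [NormedAddCommGroup E] [InnerProductSpace ℝ E]

theorem norm_iteratedFDeriv_exp_I_le (n : ℕ) (x : ℝ) :
    ‖iteratedFDeriv ℝ n (fun x : ℝ => Complex.exp (x * Complex.I)) x‖ ≤ 1 := by
  rw [norm_iteratedFDeriv_eq_norm_iteratedDeriv]
  have h : ∀ n : ℕ, iteratedDeriv n (fun x : ℝ => Complex.exp (x * Complex.I)) =
      fun x : ℝ => Complex.I ^ n * Complex.exp (x * Complex.I) := by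
    intro n
    induction n with
    | zero => simp
    | succ n ih =>
      rw [iteratedDeriv_succ, ih]
      funext x
      have h1 : HasDerivAt (fun x : ℝ => Complex.exp (x * Complex.I))
          (Complex.exp (x * Complex.I) * (1 * Complex.I)) x :=
        ((hasDerivAt_id x).ofReal_comp.mul_const Complex.I).cexp
      rw [(h1.const_mul _).deriv]
      ring
  rw [h]
  simp [Complex.norm_exp_ofReal_mul_I]

theorem norm_iteratedFDeriv_planeWave_le (ξ : E) (n : ℕ) (x : E) :
    ‖iteratedFDeriv ℝ n (planeWave ξ) x‖ ≤ (2 * Real.pi * ‖ξ‖) ^ n := by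
  set ℓ : E →L[ℝ] ℝ := (2 * Real.pi) • innerSL ℝ ξ with hℓ
  have e : planeWave ξ = (fun x : ℝ => Complex.exp (x * Complex.I)) ∘ ℓ := by
    funext t
    simp [planeWave, hℓ]
  have hn : ‖ℓ‖ = 2 * Real.pi * ‖ξ‖ := by
    rw [hℓ, norm_smul, innerSL_apply_norm, Real.norm_of_nonneg Real.two_pi_pos.le]
  rw [e, ℓ.iteratedFDeriv_comp_right (n := ∞) hasTemperateGrowth_exp_I.1 x
    (by exact_mod_cast le_top)]
  refine (ContinuousMultilinearMap.norm_compContinuousLinearMap_le _ _).trans ?_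
  rw [Finset.prod_const, Finset.card_univ, Fintype.card_fin, hn]
  exact mul_le_of_le_one_left (by positivity) (norm_iteratedFDeriv_exp_I_le n _)

/-- Here `7` stands for an upper bound of `2π`, and `1 + ‖ξ‖ ≥ 1` lets a single power serve all
orders up to `N`. -/
theorem norm_iteratedFDeriv_planeWave_le_of_le (ξ : E) {n N : ℕ} (h : n ≤ N) (x : E) :
    ‖iteratedFDeriv ℝ n (planeWave ξ) x‖ ≤ 7 ^ N * (1 + ‖ξ‖) ^ N := by
  refine (norm_iteratedFDeriv_planeWave_le ξ n x).trans ?_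
  rw [← mul_pow]
  have h7 : 2 * Real.pi ≤ 7 := by linarith [Real.pi_lt_d2]
  have h0 := norm_nonneg ξ
  calc (2 * Real.pi * ‖ξ‖) ^ n ≤ (7 * (1 + ‖ξ‖)) ^ n := by
        gcongr
        linarith
    _ ≤ (7 * (1 + ‖ξ‖)) ^ N := pow_le_pow_right₀ (by linarith) h

/-- The trigonometric series with coefficients `a` and frequencies `ξ`. -/
def trigSeries {α : Type*} (a : α → ℂ) (ξ : α → E) (x : E) : ℂ := ∑' κ, a κ * planeWave (ξ κ) x

/-- The coefficients `a` decay rapidly with respect to the frequencies `ξ`. -/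
def IsRapidlyDecreasing {α : Type*} (a : α → ℂ) (ξ : α → E) : Prop :=
  ∀ N : ℕ, Summable fun κ => ‖a κ‖ * (1 + ‖ξ κ‖) ^ N

variable {α : Type*} {a : α → ℂ} {ξ : α → E}

theorem IsRapidlyDecreasing.summable_norm (h : IsRapidlyDecreasing a ξ) :
    Summable fun κ => ‖a κ‖ := by simpa using h 0

theorem IsRapidlyDecreasing.summable (h : IsRapidlyDecreasing a ξ) (x : E) :
    Summable fun κ => a κ * planeWave (ξ κ) x :=
  Summable.of_norm (by simpa using h.summable_norm)

theorem norm_iteratedFDeriv_mul_planeWave_le (a : ℂ) (ξ : E) {n N : ℕ} (h : n ≤ N) (x : E) :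
    ‖iteratedFDeriv ℝ n (fun x => a * planeWave ξ x) x‖ ≤ 7 ^ N * (‖a‖ * (1 + ‖ξ‖) ^ N) := by
  change ‖iteratedFDeriv ℝ n (a • planeWave ξ) x‖ ≤ _
  rw [iteratedFDeriv_const_smul_apply
    ((planeWave_contDiff ξ).of_le (by exact_mod_cast le_top)).contDiffAt, norm_smul]
  calc ‖a‖ * ‖iteratedFDeriv ℝ n (planeWave ξ) x‖ ≤ ‖a‖ * (7 ^ N * (1 + ‖ξ‖) ^ N) := by
        gcongr
        exact norm_iteratedFDeriv_planeWave_le_of_le ξ h x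
    _ = _ := by ring

theorem IsRapidlyDecreasing.contDiff_trigSeries (h : IsRapidlyDecreasing a ξ) :
    ContDiff ℝ ∞ (trigSeries a ξ) :=
  contDiff_tsum (N := ⊤) (v := fun k κ => 7 ^ k * (‖a κ‖ * (1 + ‖ξ κ‖) ^ k))
    (fun κ => contDiff_const.mul (planeWave_contDiff (ξ κ))) (fun k _ => (h k).mul_left _)
    fun _ κ x _ => norm_iteratedFDeriv_mul_planeWave_le (a κ) (ξ κ) le_rfl x

theorem IsRapidlyDecreasing.norm_iteratedFDeriv_trigSeries_le (h : IsRapidlyDecreasing a ξ)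
    {n N : ℕ} (hn : n ≤ N) (x : E) :
    ‖iteratedFDeriv ℝ n (trigSeries a ξ) x‖ ≤ 7 ^ N * ∑' κ, ‖a κ‖ * (1 + ‖ξ κ‖) ^ N := by
  have e := iteratedFDeriv_tsum_apply (𝕜 := ℝ) (N := ⊤)
    (f := fun κ x => a κ * planeWave (ξ κ) x)
    (v := fun k κ => 7 ^ k * (‖a κ‖ * (1 + ‖ξ κ‖) ^ k))
    (fun κ => contDiff_const.mul (planeWave_contDiff (ξ κ))) (fun k _ => (h k).mul_left _)
    (fun k κ x _ => norm_iteratedFDeriv_mul_planeWave_le (a κ) (ξ κ) le_rfl x) (k := n) le_top x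
  have e' : iteratedFDeriv ℝ n (trigSeries a ξ) x =
    ∑' κ, iteratedFDeriv ℝ n (fun x => a κ * planeWave (ξ κ) x) x := e
  rw [e', ← tsum_mul_left]
  exact tsum_of_norm_bounded ((h N).mul_left _).hasSum fun κ =>
    norm_iteratedFDeriv_mul_planeWave_le (a κ) (ξ κ) hn x

/-- Used for the complement of a finite index set: the tail of a trigonometric series is again such
a series. -/
theorem IsRapidlyDecreasing.comp_injective {β : Type*} (h : IsRapidlyDecreasing a ξ) {e : β → α}
    (he : Function.Injective e) : IsRapidlyDecreasing (a ∘ e) (ξ ∘ e) :=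
  fun N => (h N).comp_injective he

/-- A distribution can be paired termwise with a smooth trigonometric series. -/
theorem IsRapidlyDecreasing.hasSum_apply_mulSmooth (h : IsRapidlyDecreasing a ξ)
    (p : DistributionOn E) (φ : TestFn E) :
    HasSum (fun κ => a κ * p (φ.mulSmooth (planeWave (ξ κ)) (planeWave_contDiff _)))
      (p (φ.mulSmooth (trigSeries a ξ) h.contDiff_trigSeries)) := by
  obtain ⟨N, C, hC, hp⟩ := exists_norm_apply_mulSmooth_le p φ
  rw [HasSum, SummationFilter.unconditional_filter, tendsto_iff_norm_sub_tendsto_zero]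
  have hlim := (tendsto_tsum_compl_atTop_zero fun κ => ‖a κ‖ * (1 + ‖ξ κ‖) ^ N).const_mul
    (C * 7 ^ N)
  rw [mul_zero] at hlim
  refine squeeze_zero (fun _ => norm_nonneg _) (fun s => ?_) hlim
  have ht := h.comp_injective (e := (Subtype.val : {x // x ∉ s} → α)) Subtype.val_injective
  -- The remainder after a partial sum is `φ` times the tail series, which the finite-order bound
  -- controls by the tail of a convergent series of weighted coefficients.
  have hsub : φ.mulSmooth (trigSeries a ξ) h.contDiff_trigSeries =
      ∑ κ ∈ s, a κ • φ.mulSmooth (planeWave (ξ κ)) (planeWave_contDiff _) +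
        φ.mulSmooth _ ht.contDiff_trigSeries := by
    ext x
    have := (h.summable x).sum_add_tsum_subtype_compl s
    have e2 : (∑ κ ∈ s, a κ • φ.mulSmooth (planeWave (ξ κ)) (planeWave_contDiff _)) x =
        ∑ κ ∈ s, a κ * (φ x * planeWave (ξ κ) x) := by
      simp
    simp only [FunLike.coe_add, Pi.add_apply, e2, TestFn.mulSmooth_apply]
    rw [trigSeries, ← this, trigSeries, mul_add, Finset.mul_sum]
    congr 1
    exact Finset.sum_congr rfl fun κ _ => by ring
  rw [hsub, map_add, map_sum]
  simp only [map_smul, smul_eq_mul]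
  rw [sub_add_cancel_left, norm_neg, mul_assoc]
  exact hp _ _ _ (mul_nonneg (by positivity) (tsum_nonneg fun κ => by positivity))
    fun i hi x => ht.norm_iteratedFDeriv_trigSeries_le hi x

/-- The pairings with plane waves grow at most polynomially. -/
theorem exists_norm_apply_mulSmooth_planeWave_le (p : DistributionOn E) (φ : TestFn E) :
    ∃ (N : ℕ) (C : ℝ), 0 ≤ C ∧ ∀ ξ : E,
      ‖p (φ.mulSmooth (planeWave ξ) (planeWave_contDiff ξ))‖ ≤ C * (1 + ‖ξ‖) ^ N := by
  obtain ⟨N, C, hC, hp⟩ := exists_norm_apply_mulSmooth_le p φ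
  refine ⟨N, C * 7 ^ N, by positivity, fun ξ => ?_⟩
  rw [mul_assoc]
  exact hp _ _ _ (by positivity) fun i hi x => norm_iteratedFDeriv_planeWave_le_of_le ξ hi x

end TrigSeries

/-! ### Poisson summation for a general lattice. -/

section Poisson
variable {ι : Type*} [Fintype ι] [DecidableEq ι]

/-- The periodization `∑_κ f(x + Lκ)`. -/
def periodization (L : GL ι ℝ) (f : TestFn (EuclideanSpace ℝ ι)) (x : EuclideanSpace ℝ ι) : ℂ :=
  ∑' κ : ι → ℤ, f (x + latticePoint L κ)

theorem periodization_add_latticePoint (L : GL ι ℝ) (f : TestFn (EuclideanSpace ℝ ι))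
    (x : EuclideanSpace ℝ ι) (κ : ι → ℤ) :
    periodization L f (x + latticePoint L κ) = periodization L f x := by
  unfold periodization
  rw [← (Equiv.addLeft κ).tsum_eq fun μ => f (x + latticePoint L μ)]
  simp [latticePoint_add, add_assoc]

/-- On a compact set, the periodization is a finite sum. -/
theorem exists_finset_periodization_eq_sum (L : GL ι ℝ) (f : TestFn (EuclideanSpace ℝ ι))
    {K : Set (EuclideanSpace ℝ ι)} (hK : IsCompact K) :
    ∃ s : Finset (ι → ℤ), (∀ x ∈ K, ∀ κ ∉ s, f (x + latticePoint L κ) = 0) ∧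
      ∀ x ∈ K, periodization L f x = ∑ κ ∈ s, f (x + latticePoint L κ) := by
  have hfin := finite_setOf_add_latticePoint_mem L hK f.hasCompactSupport
  have h0 : ∀ x ∈ K, ∀ κ ∉ hfin.toFinset, f (x + latticePoint L κ) = 0 := by
    intro x hx κ hκ
    by_contra hne
    exact hκ (hfin.mem_toFinset.2 ⟨x, hx, subset_tsupport _ hne⟩)
  exact ⟨hfin.toFinset, h0, fun x hx => tsum_eq_sum fun κ hκ => h0 x hx κ hκ⟩

theorem continuous_periodization (L : GL ι ℝ) (f : TestFn (EuclideanSpace ℝ ι)) :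
    Continuous (periodization L f) := by
  refine continuous_iff_continuousAt.2 fun x => ?_
  obtain ⟨s, -, hs⟩ := exists_finset_periodization_eq_sum L f (isCompact_closedBall x 1)
  have hc : Continuous fun x => ∑ κ ∈ s, f (x + latticePoint L κ) :=
    continuous_finsetSum _ fun κ _ => f.contDiff.continuous.comp (continuous_add_const _)
  refine hc.continuousAt.congr ?_
  filter_upwards [Metric.closedBall_mem_nhds x one_pos] with y hy using (hs y hy).symm

/-- The half-open unit cube at a lattice point. -/
def unitCube (κ : ι → ℤ) : Set (ι → ℝ) := {y | ∀ i, y i ∈ Set.Ioc (κ i : ℝ) (κ i + 1)}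

theorem measurableSet_unitCube (κ : ι → ℤ) : MeasurableSet (unitCube κ) :=
  MeasurableSet.univ_pi' fun _ => measurableSet_Ioc

theorem pairwise_disjoint_unitCube :
    Pairwise (Function.onFun Disjoint (unitCube : (ι → ℤ) → Set (ι → ℝ))) := by
  intro κ μ hne
  refine Set.disjoint_left.2 fun y h1 h2 => hne (funext fun i => ?_)
  have := (h1 i).1
  have := (h1 i).2
  have := (h2 i).1
  have := (h2 i).2
  have a : (κ i : ℝ) < μ i + 1 := by linarith
  have b : (μ i : ℝ) < κ i + 1 := by linarith
  norm_cast at a b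
  omega

theorem iUnion_unitCube : ⋃ κ : ι → ℤ, unitCube κ = Set.univ := by
  refine Set.eq_univ_of_forall fun y => Set.mem_iUnion.2 ⟨fun i => ⌈y i⌉ - 1, fun i => ?_⟩
  constructor
  · push_cast
    linarith [Int.ceil_lt_add_one (y i)]
  · push_cast
    linarith [Int.le_ceil (y i)]

/-- The unit cubes tile space; each is translated back to the one at the origin. -/
theorem hasSum_integral_unitCube {h : (ι → ℝ) → ℂ} (hh : Integrable h) :
    HasSum (fun κ : ι → ℤ => ∫ y in unitCube (0 : ι → ℤ), h (y + fun i => (κ i : ℝ))) (∫ y, h y) := by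
  have h1 := hasSum_integral_iUnion (μ := volume) (f := h) measurableSet_unitCube
    (pairwise_disjoint_unitCube (ι := ι)) hh.integrableOn
  rw [iUnion_unitCube, setIntegral_univ] at h1
  refine h1.congr_fun fun κ => ?_
  have h2 := (measurePreserving_add_right volume (fun i => (κ i : ℝ))).setIntegral_preimage_emb
    (measurableEmbedding_addRight (fun i => (κ i : ℝ))) h (unitCube κ)
  rw [← h2]
  congr 2
  ext y
  simp only [unitCube, Set.mem_preimage, Set.mem_ofPred_eq, Pi.add_apply, Pi.zero_apply,
    Int.cast_zero, zero_add, Set.mem_Ioc]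
  exact forall_congr' fun i => by constructor <;> rintro ⟨a, b⟩ <;> constructor <;> linarith

theorem planeWave_dualPoint_add_latticePoint (L : GL ι ℝ) (n κ : ι → ℤ) (x : EuclideanSpace ℝ ι) :
    planeWave (dualPoint L n) (x + latticePoint L κ) = planeWave (dualPoint L n) x := by
  rw [planeWave_add]
  have : planeWave (dualPoint L n) (latticePoint L κ) = 1 := by
    rw [planeWave, latticePoint_eq, inner_dualPoint, Complex.exp_eq_one_iff]
    refine ⟨∑ i, n i * κ i, ?_⟩
    simp only [intVec_apply]
    push_cast
    ring
  rw [this, mul_one]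

theorem mFourier_coe_eq_planeWave (L : GL ι ℝ) (n : ι → ℤ) (y : ι → ℝ) :
    UnitAddTorus.mFourier n (fun i => (y i : UnitAddCircle)) =
      planeWave (dualPoint L n) (matrixEquiv L (WithLp.toLp 2 y)) := by
  simp only [UnitAddTorus.mFourier, ContinuousMap.coe_mk, fourier_coe_apply, planeWave,
    inner_dualPoint, ← Complex.exp_sum]
  congr 1
  push_cast
  rw [Finset.mul_sum, Finset.sum_mul]
  exact Finset.sum_congr rfl fun i _ => by ring

/-- In the coordinates given by `L` the periodization is invariant under `ℤⁿ`, so it descends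
through the quotient map onto the torus, with its continuity. -/
theorem exists_torus_periodization (L : GL ι ℝ) (f : TestFn (EuclideanSpace ℝ ι)) :
    ∃ F : C(UnitAddTorus ι, ℂ), ∀ y : ι → ℝ,
      F (fun i => (y i : UnitAddCircle)) =
        periodization L f (matrixEquiv L (WithLp.toLp 2 y)) := by
  have hq : IsOpenQuotientMap (Pi.map fun _ : ι => ((↑) : ℝ → UnitAddCircle)) :=
    IsOpenQuotientMap.piMap fun _ => QuotientAddGroup.isOpenQuotientMap_mk
  let π : C(ι → ℝ, UnitAddTorus ι) := ⟨_, hq.continuous⟩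
  have hπ : Topology.IsQuotientMap π := hq.isQuotientMap
  let G : C(ι → ℝ, ℂ) := ⟨fun y => periodization L f (matrixEquiv L (WithLp.toLp 2 y)),
    (continuous_periodization L f).comp
      ((matrixEquiv L).continuous.comp (PiLp.continuous_toLp 2 _))⟩
  have hG : Function.FactorsThrough G π := by
    intro y z hyz
    have h : ∀ i, ∃ m : ℤ, z i = y i + m := by
      intro i
      have : ((y i : ℝ) : UnitAddCircle) = z i := congrFun hyz i
      obtain ⟨m, hm⟩ := AddSubgroup.mem_zmultiples_iff.1 (QuotientAddGroup.eq.1 this)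
      exact ⟨m, by rw [zsmul_eq_mul, mul_one] at hm; linarith⟩
    choose m hm using h
    have e : matrixEquiv L (WithLp.toLp 2 z) =
        matrixEquiv L (WithLp.toLp 2 y) + latticePoint L m := by
      rw [latticePoint_eq, ← map_add]
      congr 1
      ext i
      exact hm i
    change periodization L f _ = periodization L f _
    rw [e, periodization_add_latticePoint]
  exact ⟨hπ.lift G hG, fun y => congrArg (fun g : C(ι → ℝ, ℂ) => g y) (hπ.lift_comp G hG)⟩

theorem integral_comp_matrixEquiv (L : GL ι ℝ) {g : EuclideanSpace ℝ ι → ℂ} (hg : Continuous g) :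
    ∫ y : ι → ℝ, g (matrixEquiv L (WithLp.toLp 2 y)) =
      ((|(L : Matrix ι ι ℝ).det|⁻¹ : ℝ) : ℂ) * ∫ x, g x := by
  have hdet : (L : Matrix ι ι ℝ).det ≠ 0 := ((Matrix.isUnit_iff_isUnit_det _).1 L.isUnit).ne_zero
  have hg' : Continuous fun y : ι → ℝ => g (WithLp.toLp 2 y) :=
    hg.comp (PiLp.continuous_toLp 2 _)
  have hL : Continuous (Matrix.toLin' (L : Matrix ι ι ℝ)) :=
    LinearMap.continuous_of_finiteDimensional _
  have h1 := integral_map (μ := volume) hL.measurable.aemeasurable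
    (f := fun y : ι → ℝ => g (WithLp.toLp 2 y)) hg'.aestronglyMeasurable
  rw [Real.map_matrix_volume_pi_eq_smul_volume_pi hdet, integral_smul_measure,
    (PiLp.volume_preserving_toLp ι).integral_comp
      (MeasurableEquiv.toLp 2 (ι → ℝ)).measurableEmbedding] at h1
  rw [ENNReal.toReal_ofReal (abs_nonneg _), abs_inv, Complex.real_smul] at h1
  exact h1.symm

theorem fourier_eq_integral_planeWave {E : Type*} [NormedAddCommGroup E] [InnerProductSpace ℝ E]
    [FiniteDimensional ℝ E] [MeasurableSpace E] [BorelSpace E] (f : 𝓢(E, ℂ)) (ξ : E) :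
    𝓕 f ξ = ∫ x, planeWave (-ξ) x * f x := by
  rw [SchwartzMap.fourier_coe, Real.fourier_eq']
  refine integral_congr_ae (Eventually.of_forall fun x => ?_)
  simp only [planeWave, smul_eq_mul, inner_neg_left]
  rw [real_inner_comm]
  congr 3
  push_cast
  ring

/-- Unfolding: the plane wave is lattice-periodic, so the integral over one cube of a sum of
translates becomes an integral over the whole space; the linear change of variables by `L`
contributes `|det L|⁻¹`. -/
theorem mFourierCoeff_eq_fourier (L : GL ι ℝ) (f : TestFn (EuclideanSpace ℝ ι))
    {F : UnitAddTorus ι → ℂ}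
    (hF : ∀ y : ι → ℝ, F (fun i => (y i : UnitAddCircle)) =
        periodization L f (matrixEquiv L (WithLp.toLp 2 y))) (n : ι → ℤ) :
    UnitAddTorus.mFourierCoeff F n =
      ((|(L : Matrix ι ι ℝ).det|⁻¹ : ℝ) : ℂ) * 𝓕 f.toSchwartz (dualPoint L n) := by
  set G : EuclideanSpace ℝ ι → ℂ := fun x => planeWave (-dualPoint L n) x * f x with hG
  have hGc : Continuous G := (planeWave_contDiff _).continuous.mul f.contDiff.continuous
  set Φ : (ι → ℝ) → EuclideanSpace ℝ ι := fun y => matrixEquiv L (WithLp.toLp 2 y) with hΦ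
  have hΦc : Continuous Φ := (matrixEquiv L).continuous.comp (PiLp.continuous_toLp 2 _)
  have hΦadd : ∀ (y : ι → ℝ) (κ : ι → ℤ),
      Φ (y + fun i => (κ i : ℝ)) = Φ y + latticePoint L κ := by
    intro y κ
    rw [latticePoint_eq, hΦ]
    simp only
    rw [← map_add]
    rfl
  have hGs : HasCompactSupport (fun y => G (Φ y)) := by
    have : HasCompactSupport G := f.hasCompactSupport.mul_left
    exact this.comp_homeomorph
      ((PiLp.continuousLinearEquiv 2 ℝ fun _ : ι => ℝ).symm.trans (matrixEquiv L)).toHomeomorph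
  have hint : Integrable (fun y => G (Φ y)) := (hGc.comp hΦc).integrable_of_hasCompactSupport hGs
  have hsum := hasSum_integral_unitCube hint
  -- Passing to the closed cube gives compactness, so one finite set of translates suffices on the
  -- whole cube and the sum and integral interchange trivially.
  have hK : IsCompact (Φ '' {y | ∀ i, y i ∈ Set.Icc (0 : ℝ) 1}) := by
    have : {y : ι → ℝ | ∀ i, y i ∈ Set.Icc (0 : ℝ) 1} = Set.univ.pi fun _ => Set.Icc (0 : ℝ) 1 := by
      ext y; simp only [Set.mem_ofPred_eq, Set.mem_pi, Set.mem_univ, true_imp_iff]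
    rw [this]
    exact (isCompact_univ_pi fun _ => isCompact_Icc).image hΦc
  have hcube : ∀ y ∈ unitCube (0 : ι → ℤ), Φ y ∈ Φ '' {y | ∀ i, y i ∈ Set.Icc (0 : ℝ) 1} := by
    intro y hy
    refine ⟨y, fun i => ?_, rfl⟩
    have := hy i
    simp only [Pi.zero_apply, Int.cast_zero, zero_add] at this
    exact ⟨this.1.le, this.2⟩
  obtain ⟨s, hs0, hs⟩ := exists_finset_periodization_eq_sum L f hK
  have hGper : ∀ (y : ι → ℝ) (κ : ι → ℤ), G (Φ (y + fun i => (κ i : ℝ))) =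
      planeWave (-dualPoint L n) (Φ y) * f (Φ y + latticePoint L κ) := by
    intro y κ
    rw [hΦadd, hG]
    simp only
    rw [← dualPoint_neg, planeWave_dualPoint_add_latticePoint]
  have hval := hsum.unique (hasSum_sum_of_ne_finset_zero (L := SummationFilter.unconditional _)
    (s := s) fun κ hκ => by
      rw [setIntegral_congr_fun (g := fun _ => 0) (measurableSet_unitCube _), integral_zero]
      intro y hy
      simp only
      rw [hGper, hs0 _ (hcube y hy) κ hκ, mul_zero])
  rw [UnitAddTorus.mFourierCoeff_eq_integral F n 0, fourier_eq_integral_planeWave,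
    ← integral_comp_matrixEquiv L (g := fun x => planeWave (-dualPoint L n) x * f.toSchwartz x) hGc]
  refine Eq.trans ?_ hval.symm
  rw [← integral_finsetSum]
  · have e : {x : ι → ℝ | ∀ i, x i ∈ Set.Ioc ((0 : ι → ℝ) i) ((0 : ι → ℝ) i + 1)} =
        unitCube (0 : ι → ℤ) := by
      simp [unitCube]
    rw [e]
    refine setIntegral_congr_fun (measurableSet_unitCube _) fun y hy => ?_
    rw [hF, mFourier_coe_eq_planeWave L, dualPoint_neg, smul_eq_mul, hs _ (hcube y hy),
      Finset.mul_sum]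
    exact Finset.sum_congr rfl fun κ _ => (hGper y κ).symm
  · intro κ _
    exact (hint.comp_add_right _).integrableOn

theorem norm_mul_one_add_pow_le {E : Type*} [NormedAddCommGroup E] [NormedSpace ℝ E] (g : 𝓢(E, ℂ))
    (N : ℕ) (ξ : E) : ‖g ξ‖ * (1 + ‖ξ‖) ^ N ≤
      2 ^ N * (Finset.Iic (N, 0)).sup (schwartzSeminormFamily ℂ E ℂ) g := by
  have := SchwartzMap.one_add_le_sup_seminorm_apply (𝕜 := ℂ) (m := (N, 0)) le_rfl le_rfl g ξ
  rw [norm_iteratedFDeriv_zero] at this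
  rw [mul_comm]
  exact this

theorem isRapidlyDecreasing_schwartz (M : GL ι ℝ) (g : 𝓢(EuclideanSpace ℝ ι, ℂ)) :
    IsRapidlyDecreasing (fun κ : ι → ℤ => g (matrixEquiv M (intVec κ)))
      fun κ => matrixEquiv M (intVec κ) := by
  intro N
  have hs := summable_one_add_norm_pow_inv M (Nat.lt_succ_self (Fintype.card ι))
  refine Summable.of_nonneg_of_le (fun κ => by positivity) (fun κ => ?_)
    -- Decay of order `N + card ι + 1`: the first `N` powers absorb the weight, the remaining ones
    -- give summability.
    (hs.mul_left (2 ^ (N + (Fintype.card ι).succ) * (Finset.Iic (N + (Fintype.card ι).succ, 0)).sup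
      (schwartzSeminormFamily ℂ (EuclideanSpace ℝ ι) ℂ) g))
  rw [← div_eq_mul_inv, le_div_iff₀ (by positivity), mul_assoc, ← pow_add]
  exact norm_mul_one_add_pow_le g _ _

theorem isRapidlyDecreasing_fourier (L : GL ι ℝ) (c : ℂ) (f : 𝓢(EuclideanSpace ℝ ι, ℂ)) :
    IsRapidlyDecreasing (fun κ : ι → ℤ => c * 𝓕 f (dualPoint L κ)) (dualPoint L) := by
  intro N
  refine ((isRapidlyDecreasing_schwartz (dualGL L) (𝓕 f) N).mul_left ‖c‖).congr fun κ => ?_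
  rw [norm_mul, mul_assoc]
  rfl

/-- Poisson summation for test functions and the lattice `Lℤⁿ`. -/
theorem periodization_eq_trigSeries (L : GL ι ℝ) (f : TestFn (EuclideanSpace ℝ ι)) :
    periodization L f = trigSeries (fun κ : ι → ℤ =>
      ((|(L : Matrix ι ι ℝ).det|⁻¹ : ℝ) : ℂ) * 𝓕 f.toSchwartz (dualPoint L κ)) (dualPoint L) := by
  obtain ⟨F, hF⟩ := exists_torus_periodization L f
  have hc := mFourierCoeff_eq_fourier L f hF
  -- Absolute summability of the coefficients, together with continuity of `F`, gives convergence of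
  -- the Fourier series at every point.
  have hsum : Summable (UnitAddTorus.mFourierCoeff F) := by
    rw [funext hc]
    exact (isRapidlyDecreasing_fourier L _ f.toSchwartz).summable_norm.of_norm
  funext x
  set y : ι → ℝ := ((matrixEquiv L).symm x).ofLp with hy
  have hx : matrixEquiv L (WithLp.toLp 2 y) = x := by simp [hy]
  have h := UnitAddTorus.hasSum_mFourier_series_apply_of_summable hsum
    fun i => (y i : UnitAddCircle)
  simp only [hc, hF, mFourier_coe_eq_planeWave L, hx] at h
  exact h.tsum_eq.symm

end Poisson

/-! ### Fourier series of periodic distributions. -/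

section FourierSeries
variable {ι : Type*} [Fintype ι] [DecidableEq ι] {L : GL ι ℝ}
  {p : DistributionOn (EuclideanSpace ℝ ι)} {φ : TestFn (EuclideanSpace ℝ ι)}

/-- Unfolding: a periodic distribution sees a test function through its periodization. -/
theorem IsLatticePeriodic.apply_eq_mulSmooth (hp : IsLatticePeriodic L p)
    (hφ : IsLatticePartition L φ) (f : TestFn (EuclideanSpace ℝ ι)) {ψ : EuclideanSpace ℝ ι → ℂ}
    (hψ : ContDiff ℝ ∞ ψ) (h : periodization L f = ψ) : p f = p (φ.mulSmooth ψ hψ) := by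
  obtain ⟨s, hs0, hs⟩ := exists_finset_periodization_eq_sum L f φ.hasCompactSupport
  set g : (ι → ℤ) → TestFn (EuclideanSpace ℝ ι) := fun κ =>
    φ.mulSmooth (f.shift (latticePoint L κ)) (f.shift (latticePoint L κ)).contDiff with hg
  -- Multiply `f` by `∑_κ φ(· - Lκ) = 1`; the term at `κ` is a lattice translate of `φ · f(· + Lκ)`,
  -- and `p` does not see the translation. The same pieces without the translations add up to `φ`
  -- times the periodization.
  have h1 : f = ∑ κ ∈ s, (g κ).shift (latticePoint L (-κ)) := by
    ext x
    have hsum := (hφ x).mul_right (f x)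
    have hfin := hasSum_sum_of_ne_finset_zero (L := SummationFilter.unconditional _) (s := s)
      (f := fun κ => φ (x - latticePoint L κ) * f x) fun κ hκ => by
        by_cases hx : x - latticePoint L κ ∈ tsupport φ
        · have := hs0 _ hx κ hκ
          rw [sub_add_cancel] at this
          rw [this, mul_zero]
        · rw [image_eq_zero_of_notMem_tsupport hx, zero_mul]
    have := hsum.unique hfin
    rw [one_mul] at this
    rw [this]
    simp [hg, latticePoint_neg, ← sub_eq_add_neg]
  have h2 : φ.mulSmooth ψ hψ = ∑ κ ∈ s, g κ := by
    ext x
    have e : (∑ κ ∈ s, g κ) x = ∑ κ ∈ s, φ x * f (x + latticePoint L κ) := by simp [hg]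
    rw [e, ← Finset.mul_sum, TestFn.mulSmooth_apply, ← h]
    by_cases hx : x ∈ tsupport φ
    · rw [hs x hx]
    · rw [image_eq_zero_of_notMem_tsupport hx, zero_mul, zero_mul]
  rw [h2, map_sum]
  conv_lhs => rw [h1]
  rw [map_sum]
  exact Finset.sum_congr rfl fun κ _ => hp (-κ) (g κ)

/-- The Fourier series of a periodic distribution, tested against a test function. -/
theorem IsLatticePeriodic.hasSum_latticeFourierCoeff_testFn (hp : IsLatticePeriodic L p)
    (hφ : IsLatticePartition L φ) (f : TestFn (EuclideanSpace ℝ ι)) :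
    HasSum (fun κ : ι → ℤ => latticeFourierCoeff L φ p κ * 𝓕 f.toSchwartz (-dualPoint L κ))
      (p f) := by
  have hrd := isRapidlyDecreasing_fourier L ((|(L : Matrix ι ι ℝ).det|⁻¹ : ℝ) : ℂ) f.toSchwartz
  have h := hrd.hasSum_apply_mulSmooth p φ
  rw [← hp.apply_eq_mulSmooth hφ f hrd.contDiff_trigSeries (periodization_eq_trigSeries L f)] at h
  -- Poisson summation pairs `p` with the plane wave of frequency `L⁻ᵀκ`, while the coefficient
  -- `c_κ` uses `-L⁻ᵀκ`; hence the reindexing.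
  rw [← (Equiv.neg (ι → ℤ)).hasSum_iff]
  refine h.congr_fun fun κ => ?_
  have e : ∀ ξ η : EuclideanSpace ℝ ι, ξ = η →
      p (φ.mulSmooth (planeWave ξ) (planeWave_contDiff _)) =
        p (φ.mulSmooth (planeWave η) (planeWave_contDiff _)) := by
    rintro ξ _ rfl
    rfl
  simp only [Function.comp_apply, Equiv.neg_apply, latticeFourierCoeff, torusPairing]
  rw [e (-dualPoint L (-κ)) (dualPoint L κ) (by rw [dualPoint_neg, neg_neg]), dualPoint_neg,
    neg_neg]
  ring

theorem exists_norm_latticeFourierCoeff_le (L : GL ι ℝ) (φ : TestFn (EuclideanSpace ℝ ι))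
    (p : DistributionOn (EuclideanSpace ℝ ι)) :
    ∃ (N : ℕ) (C : ℝ), 0 ≤ C ∧ ∀ κ : ι → ℤ,
      ‖latticeFourierCoeff L φ p κ‖ ≤ C * (1 + ‖dualPoint L κ‖) ^ N := by
  obtain ⟨N, C, hC, h⟩ := exists_norm_apply_mulSmooth_planeWave_le p φ
  refine ⟨N, |(L : Matrix ι ι ℝ).det|⁻¹ * C, by positivity, fun κ => ?_⟩
  have := h (-dualPoint L κ)
  rw [norm_neg] at this
  rw [latticeFourierCoeff, norm_mul, Complex.norm_real, norm_inv, Real.norm_eq_abs, abs_abs,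
    mul_assoc]
  exact mul_le_mul_of_nonneg_left this (by positivity)

/-- A series of point evaluations at dual lattice points, with coefficients of polynomial growth,
is a tempered distribution. -/
theorem exists_hasSum_mul_apply_neg_dualPoint (L : GL ι ℝ) {c : (ι → ℤ) → ℂ} {N : ℕ} {C : ℝ}
    (hC : 0 ≤ C) (hc : ∀ κ, ‖c κ‖ ≤ C * (1 + ‖dualPoint L κ‖) ^ N) :
    ∃ A : 𝓢(EuclideanSpace ℝ ι, ℂ) →L[ℂ] ℂ, ∀ g : 𝓢(EuclideanSpace ℝ ι, ℂ),
      HasSum (fun κ => c κ * g (-dualPoint L κ)) (A g) := by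
  -- `N` powers compensate the growth of `c`; `card ι + 1` more make the series summable.
  set M := N + (Fintype.card ι).succ with hM
  set S : 𝓢(EuclideanSpace ℝ ι, ℂ) → ℝ := fun g =>
    (Finset.Iic (M, 0)).sup (schwartzSeminormFamily ℂ (EuclideanSpace ℝ ι) ℂ) g with hS
  set w : (ι → ℤ) → ℝ := fun κ => ((1 + ‖dualPoint L κ‖) ^ (Fintype.card ι).succ)⁻¹ with hw
  have hwsum : Summable w :=
    summable_one_add_norm_pow_inv (dualGL L) (Nat.lt_succ_self (Fintype.card ι))
  have hbound : ∀ (g : 𝓢(EuclideanSpace ℝ ι, ℂ)) κ,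
      ‖c κ * g (-dualPoint L κ)‖ ≤ C * (2 ^ M * S g) * w κ := by
    intro g κ
    have h := norm_mul_one_add_pow_le g M (-dualPoint L κ)
    rw [norm_neg] at h
    rw [hw, norm_mul, ← div_eq_mul_inv, le_div_iff₀ (by positivity)]
    calc ‖c κ‖ * ‖g (-dualPoint L κ)‖ * (1 + ‖dualPoint L κ‖) ^ (Fintype.card ι).succ
        ≤ C * (1 + ‖dualPoint L κ‖) ^ N * ‖g (-dualPoint L κ)‖ *
          (1 + ‖dualPoint L κ‖) ^ (Fintype.card ι).succ := by gcongr; exact hc κ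
      _ = C * (‖g (-dualPoint L κ)‖ * (1 + ‖dualPoint L κ‖) ^ M) := by rw [hM, pow_add]; ring
      _ ≤ C * (2 ^ M * S g) := by gcongr
  have hsum : ∀ g : 𝓢(EuclideanSpace ℝ ι, ℂ), Summable fun κ => c κ * g (-dualPoint L κ) :=
    fun g => (hwsum.mul_left _).of_norm_bounded (hbound g)
  refine ⟨SchwartzMap.mkCLMtoNormedSpace (σ := RingHom.id ℂ)
    (fun g => ∑' κ, c κ * g (-dualPoint L κ)) (fun f g => ?_) (fun a f => ?_)
    ⟨Finset.Iic (M, 0), C * 2 ^ M * ∑' κ, w κ, ?_, fun g => ?_⟩, fun g => (hsum g).hasSum⟩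
  · rw [← (hsum f).tsum_add (hsum g)]
    exact tsum_congr fun κ => by simp [mul_add]
  · rw [RingHom.id_apply, smul_eq_mul, ← tsum_mul_left]
    exact tsum_congr fun κ => by simp; ring
  · exact mul_nonneg (by positivity) (tsum_nonneg fun κ => by positivity)
  · have := tsum_of_norm_bounded ((hwsum.mul_left _).hasSum) (hbound g)
    refine this.trans (le_of_eq ?_)
    rw [tsum_mul_left]
    ring

/-- A periodic distribution extends to a tempered one, given by its Fourier series. -/
theorem IsLatticePeriodic.exists_temperedExtension (hp : IsLatticePeriodic L p)
    (hφ : IsLatticePartition L φ) :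
    ∃ P : 𝓢'(EuclideanSpace ℝ ι, ℂ), IsTemperedExtension p P ∧
      ∀ f : 𝓢(EuclideanSpace ℝ ι, ℂ),
        HasSum (fun κ : ι → ℤ => latticeFourierCoeff L φ p κ * 𝓕 f (-dualPoint L κ)) (P f) := by
  obtain ⟨N, C, hC, hc⟩ := exists_norm_latticeFourierCoeff_le L φ p
  obtain ⟨A, hA⟩ := exists_hasSum_mul_apply_neg_dualPoint L hC hc
  let P : 𝓢'(EuclideanSpace ℝ ι, ℂ) := ContinuousLinearMap.toPointwiseConvergenceCLM _ _ _ _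
    (A ∘L FourierTransform.fourierCLM ℂ 𝓢(EuclideanSpace ℝ ι, ℂ))
  have hP : ∀ f : 𝓢(EuclideanSpace ℝ ι, ℂ),
      HasSum (fun κ : ι → ℤ => latticeFourierCoeff L φ p κ * 𝓕 f (-dualPoint L κ)) (P f) :=
    fun f => hA (𝓕 f)
  exact ⟨P, fun f => (hP f.toSchwartz).unique (hp.hasSum_latticeFourierCoeff_testFn hφ f), hP⟩

/-- Uniqueness identifies any tempered extension with the one built from the given `φ`, so the
expansion does not depend on how the extension was obtained. -/
theorem IsTemperedExtension.hasSum_latticeFourierCoeff (hp : IsLatticePeriodic L p)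
    (hφ : IsLatticePartition L φ) {P : 𝓢'(EuclideanSpace ℝ ι, ℂ)} (hP : IsTemperedExtension p P)
    (f : 𝓢(EuclideanSpace ℝ ι, ℂ)) :
    HasSum (fun κ : ι → ℤ => latticeFourierCoeff L φ p κ * 𝓕 f (-dualPoint L κ)) (P f) := by
  obtain ⟨Q, hQ, hsum⟩ := hp.exists_temperedExtension hφ
  rw [hP.unique hQ]
  exact hsum f

end FourierSeries

/-- Convergence of series in the weak topology can be tested pointwise. -/
theorem hasSum_pointwiseConvergenceCLM {E α : Type*} [NormedAddCommGroup E] [NormedSpace ℝ E]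
    {f : α → 𝓢'(E, ℂ)} {P : 𝓢'(E, ℂ)} (h : ∀ v, HasSum (fun κ => f κ v) (P v)) : HasSum f P := by
  refine PointwiseConvergenceCLM.tendsto_iff_forall_tendsto.2 fun v => ?_
  refine (h v).congr fun s => ?_
  exact (map_sum (PointwiseConvergenceCLM.evalCLM (RingHom.id ℂ) ℂ v) f s).symm

end TauQuantization

end

theorem proposition3p1 {d : ℕ} (L : GL (Fin d ⊕ Fin d) ℝ) (p : DistributionOn (PhaseSpace d))
    (hp : IsLatticePeriodic L p) :
    (∃ φ : TestFn (PhaseSpace d), IsLatticePartition L φ) ∧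
    (∃! P : 𝓢'(PhaseSpace d, ℂ), IsTemperedExtension p P) ∧
    ∀ φ : TestFn (PhaseSpace d), IsLatticePartition L φ →
      ∀ P : 𝓢'(PhaseSpace d, ℂ), IsTemperedExtension p P →
        ∀ τ ∈ Set.Icc (0 : ℝ) 1, ∀ u : 𝓢(Config d, ℂ),
          HasSum
            (fun κ : Fin d ⊕ Fin d → ℤ =>
              (latticeFourierCoeff L φ p κ *
                Complex.exp (2 * Real.pi * Complex.I * τ *
                  (inner ℝ (PhaseSpace.snd (dualPoint L κ)) (PhaseSpace.fst (dualPoint L κ)) : ℝ))) •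
                (timeFreqShift (symplecticJ (dualPoint L κ)) u : 𝓢'(Config d, ℂ)))
            (opTau τ P u) := by
  obtain ⟨φ₀, hφ₀⟩ := exists_isLatticePartition L
  obtain ⟨P₀, hP₀, -⟩ := hp.exists_temperedExtension hφ₀
  refine ⟨⟨φ₀, hφ₀⟩, ⟨P₀, hP₀, fun Q hQ => hQ.unique hP₀⟩, fun φ hφ P hP τ _ u => ?_⟩
  refine hasSum_pointwiseConvergenceCLM fun v => ?_
  -- The Fourier series of the symbol tested on the cross-Wigner function is already the operator
  -- series tested on `v`.
  have h := IsTemperedExtension.hasSum_latticeFourierCoeff hp hφ hP (crossWigner τ u v)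
  rw [← opTau_apply] at h
  refine h.congr_fun fun κ => ?_
  rw [fourier_crossWigner_neg]
  exact mul_assoc _ _ _
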